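/- Let $P$ be a smooth manifold without boundary of dimension $2m$ (Hausdorff, second countable) with a smooth $1$-form $\lambda$ such that $d\lambda$ is symplectic. Equip the contactization $P\times\mathbb R$ with the contact form $\alpha = dz-\lambda$, and the symplectization $X=\mathbb R_s\times(P\times\mathbb R)$ with the symplectic form $\omega=d(e^s\alpha)$; put $n=m+1$, so that $\dim X=2n$. Let $\Lambda_-,\Lambda_+\subset P\times\mathbb R$ be closed (compact, boundaryless) Legendrian submanifolds, with $\Lambda_+\neq\emptyset$, and let $L\subset X$ be an exact Lagrangian cobordism from $\Lambda_-$ to $\Lambda_+$: a properly embedded Lagrangian submanifold for which there are real numbers $s_-\le s_+$ with $$L\cap\big((-\infty,s_-]\times(P\times\mathbb R)\big)=(-\infty,s_-]\times\Lambda_-,\qquad L\cap\big([s_+,\infty)\times(P\times\mathbb R)\big)=[s_+,\infty)\times\Lambda_+,$$ and a smooth function $f:L\to\mathbb R$ with $e^s\alpha|_L=df$ and $f=0$ on $(-\infty,s_-]\times\Lambda_-$. ($L$ may, but need not, be orientable and have vanishing Maslov class.) For $-\infty\le a<b\le\infty$ let $L_a^b=L\cap\big((a,b)\times(P\times\mathbb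 R)\big)$ and let its relative Gromov width be $$w(L_a^b)=\sup\{\pi r^2\}\in[0,\infty],$$ the supremum over all $r>0$ for which there is a smooth embedding $\psi$ of the closed ball $B^{2n}(r)\subset(\mathbb R^{2n},\omega_0=\sum dx_i\wedge dy_i)$ into $(a,b)\times(P\times\mathbb R)$ with $\psi^*\omega=\omega_0$ and $\psi^{-1}(L_a^b)=B^{2n}(r)\cap\{y=0\}$ (and $\sup\emptyset=0$). Then for every $s_0$ with $-\infty\le s_0<\infty$, $$w(L_{s_0}^{\infty})=\infty.$$ -/

import Mathlib

open Set Filter Topology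
open scoped Manifold ContDiff

noncomputable section

/-! ### Differential one-forms and submanifolds of manifolds without boundary -/

section Manifold

variable {E : Type*} [NormedAddCommGroup E] [NormedSpace ℝ E] {H : Type*} [TopologicalSpace H]

/-- A (not necessarily smooth) one-form on `M`. -/
abbrev OneForm (I : ModelWithCorners ℝ E H) (M : Type*) [TopologicalSpace M] [ChartedSpace H M] :=
  ∀ x : M, TangentSpace I x →L[ℝ] ℝ

variable {I : ModelWithCorners ℝ E H} {M : Type*} [TopologicalSpace M] [ChartedSpace H M]

/-- The local expression of the one-form `β` in the preferred chart `φ` around `x₀`, that is, the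
pullback of `β` under `φ⁻¹`, as a field of linear forms on the model space. Only its values on the
target of the chart matter. -/
def OneForm.localExpr (β : OneForm I M) (x₀ : M) (y : E) : E →L[ℝ] ℝ :=
  (β ((extChartAt I x₀).symm y)).comp (mfderiv 𝓘(ℝ, E) I (extChartAt I x₀).symm y)

/-- Smoothness of a one-form: its local expressions are smooth. -/
def OneForm.IsSmooth (β : OneForm I M) : Prop :=
  ∀ x₀ : M, ContDiffOn ℝ ∞ (β.localExpr x₀) (extChartAt I x₀).target

/-- The exterior derivative `(dβ)_x(v, w)` of a one-form on a manifold without boundary: the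
exterior derivative on the model space of the local expression of `β` around `x`, pulled back by
the chart. -/
def OneForm.d (β : OneForm I M) (x : M) (v w : TangentSpace I x) : ℝ :=
  extDeriv (fun y : E => ContinuousAlternatingMap.ofSubsingleton ℝ E ℝ (0 : Fin 1) (β.localExpr x y))
    (extChartAt I x x)
    ![mfderiv I 𝓘(ℝ, E) (extChartAt I x) x v, mfderiv I 𝓘(ℝ, E) (extChartAt I x) x w]

variable (I) in
/-- `S` is an embedded `k`-dimensional smooth submanifold of `M` (without boundary): around each
point of `S` there is a smooth chart of `M` in which `S` is a `k`-dimensional linear subspace. -/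
def IsEmbeddedSubmanifold (k : ℕ) (S : Set M) : Prop :=
  ∀ p ∈ S, ∃ φ ∈ IsManifold.maximalAtlas I ∞ M, p ∈ φ.source ∧
    ∃ V : Submodule ℝ E, Module.finrank ℝ V = k ∧ ∀ q ∈ φ.source, q ∈ S ↔ I (φ q) ∈ V

variable (I) in
/-- `γ`, defined near `0`, is a smooth curve in `M` that stays in `S`. -/
def IsSmoothCurveIn (S : Set M) (γ : ℝ → M) : Prop :=
  ContMDiffAt 𝓘(ℝ, ℝ) I ∞ γ 0 ∧ ∀ᶠ t in 𝓝 (0 : ℝ), γ t ∈ S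

variable (I) in
/-- The velocity `γ'(0)`. -/
def velocity (γ : ℝ → M) : TangentSpace I (γ 0) :=
  mfderiv 𝓘(ℝ, ℝ) I γ 0 (1 : ℝ)

variable (I) in
/-- The vectors at `p` tangent to the submanifold `S`: velocities of smooth curves in `S`. -/
def tangentVectors (S : Set M) (p : M) : Set (TangentSpace I p) :=
  {v | ∃ γ : ℝ → M, γ 0 = p ∧ IsSmoothCurveIn I S γ ∧ (velocity I γ : E) = (v : E)}

end Manifold

/-! ### Liouville manifolds, contactizations, symplectizations

The Liouville manifold `P` has dimension `2 * m`, its contactization is `P × ℝ`, of dimension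
`2 * m + 1`, and the symplectization of the latter is `ℝ × (P × ℝ)`, of dimension
`2 * (m + 1)`. -/

/-- The model of the contactization. -/
abbrev contModel (m : ℕ) := (𝓡 (2 * m)).prod 𝓘(ℝ, ℝ)

/-- The model of the symplectization. -/
abbrev sympModel (m : ℕ) := 𝓘(ℝ, ℝ).prod (contModel m)

section Symplectization

variable {m : ℕ} {P : Type*} [TopologicalSpace P] [ChartedSpace (EuclideanSpace ℝ (Fin (2 * m))) P]

/-- `lam` is a Liouville form: a smooth one-form such that `d lam` is symplectic (nondegenerate;
it is closed because it is exact). -/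
structure IsLiouvilleForm (lam : OneForm (𝓡 (2 * m)) P) : Prop where
  smooth : lam.IsSmooth
  nondegenerate : ∀ (x : P) (v : TangentSpace (𝓡 (2 * m)) x), (∀ w, lam.d x v w = 0) → v = 0

/-- The one-form `dz` on the contactization `P × ℝ`, with `z` the second coordinate. -/
def dzForm (m : ℕ) (P : Type*) [TopologicalSpace P]
    [ChartedSpace (EuclideanSpace ℝ (Fin (2 * m))) P] : OneForm (contModel m) (P × ℝ) := fun y =>
  mfderiv (contModel m) 𝓘(ℝ, ℝ) (Prod.snd : P × ℝ → ℝ) y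

/-- The contact form `α = dz - lam` on the contactization `P × ℝ`. -/
def contactForm (lam : OneForm (𝓡 (2 * m)) P) : OneForm (contModel m) (P × ℝ) := fun y =>
  dzForm m P y -
    (lam y.1).comp (mfderiv (contModel m) (𝓡 (2 * m)) (Prod.fst : P × ℝ → P) y)

/-- The one-form `e^s α` on the symplectization `ℝ × (P × ℝ)`, with `s` the first coordinate. -/
def expContactForm (lam : OneForm (𝓡 (2 * m)) P) :
    OneForm (sympModel m) (ℝ × (P × ℝ)) := fun x =>
  Real.exp x.1 • (contactForm lam x.2).comp
    (mfderiv (sympModel m) (contModel m) (Prod.snd : ℝ × (P × ℝ) → P × ℝ) x)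

/-- The symplectic form `ω = d(e^s α)` of the symplectization. -/
def sympForm (lam : OneForm (𝓡 (2 * m)) P) (x : ℝ × (P × ℝ))
    (v w : TangentSpace (sympModel m) x) : ℝ :=
  (expContactForm lam).d x v w

/-- `Lam` is a closed (compact without boundary, possibly empty or disconnected) Legendrian
submanifold of the contactization. -/
structure IsClosedLegendrian (lam : OneForm (𝓡 (2 * m)) P) (Lam : Set (P × ℝ)) : Prop where
  submanifold : IsEmbeddedSubmanifold (contModel m) m Lam
  compact : IsCompact Lam
  legendrian : ∀ y ∈ Lam, ∀ v ∈ tangentVectors (contModel m) Lam y, contactForm lam y v = 0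

/-- `L` is an exact Lagrangian cobordism from `LamM` to `LamP` in the symplectization.
Orientability of `L` and vanishing of its Maslov class, which are often part of the definition, are
not required, so that this class of cobordisms contains the more restrictive one.
An embedded submanifold is properly embedded exactly when it is a closed subset. -/
structure IsLagrangianCobordism (lam : OneForm (𝓡 (2 * m)) P) (LamM LamP : Set (P × ℝ))
    (L : Set (ℝ × (P × ℝ))) : Prop where
  submanifold : IsEmbeddedSubmanifold (sympModel m) (m + 1) L
  closed : IsClosed L
  lagrangian : ∀ x ∈ L, ∀ v ∈ tangentVectors (sympModel m) L x,
    ∀ w ∈ tangentVectors (sympModel m) L x, sympForm lam x v w = 0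
  legendrianM : IsClosedLegendrian lam LamM
  legendrianP : IsClosedLegendrian lam LamP
  /-- `L` is cylindrical outside `[sM, sP]`, and `e^s α` restricted to `L` is the differential of a
  smooth function `f` on `L` that vanishes on the negative cylindrical end. -/
  cylindrical_exact : ∃ sM sP : ℝ, sM ≤ sP ∧
    L ∩ (Iic sM ×ˢ univ) = Iic sM ×ˢ LamM ∧
    L ∩ (Ici sP ×ˢ univ) = Ici sP ×ˢ LamP ∧
    ∃ f : ℝ × (P × ℝ) → ℝ, ContMDiffOn (sympModel m) 𝓘(ℝ, ℝ) ∞ f L ∧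
      (∀ γ : ℝ → ℝ × (P × ℝ), IsSmoothCurveIn (sympModel m) L γ →
        HasDerivAt (fun t => f (γ t)) (expContactForm lam (γ 0) (velocity (sympModel m) γ)) 0) ∧
      ∀ x ∈ Iic sM ×ˢ LamM, f x = 0

/-! ### Relative Gromov width -/

/-- The standard symplectic space `ℝ^{2n}`, with coordinates `x_i` (at `Sum.inl i`) and `y_i`
(at `Sum.inr i`) and the Euclidean norm. -/
abbrev StdSpace (n : ℕ) := EuclideanSpace ℝ (Fin n ⊕ Fin n)

/-- The standard symplectic form `ω₀ = ∑ dx_i ∧ dy_i`. -/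
def stdForm {n : ℕ} (v w : StdSpace n) : ℝ :=
  ∑ i : Fin n, (v (Sum.inl i) * w (Sum.inr i) - v (Sum.inr i) * w (Sum.inl i))

/-- The Lagrangian plane `ℝ^n = {y = 0}` in `ℝ^{2n}`. -/
def realPlane (n : ℕ) : Set (StdSpace n) := {z | ∀ i : Fin n, z (Sum.inr i) = 0}

/-- `ψ` restricts to a symplectic embedding of the closed ball `B^{2(m+1)}(r)` into the open set
`U` of the symplectization relative to `L`: it is smooth on a neighbourhood of the ball, injective
on the ball, pulls `ω` back to `ω₀` on the ball (in particular it is an immersion there), and it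
satisfies `ψ⁻¹(L) = B(r) ∩ ℝ^{m+1}`. -/
structure IsRelSymplecticEmbedding (lam : OneForm (𝓡 (2 * m)) P) (U L : Set (ℝ × (P × ℝ)))
    (r : ℝ) (ψ : StdSpace (m + 1) → ℝ × (P × ℝ)) : Prop where
  smooth : ∃ O : Set (StdSpace (m + 1)), IsOpen O ∧ Metric.closedBall 0 r ⊆ O ∧
    ContMDiffOn 𝓘(ℝ, StdSpace (m + 1)) (sympModel m) ∞ ψ O
  injOn : InjOn ψ (Metric.closedBall 0 r)
  mapsTo : MapsTo ψ (Metric.closedBall 0 r) U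
  symplectic : ∀ z ∈ Metric.closedBall (0 : StdSpace (m + 1)) r, ∀ v w : StdSpace (m + 1),
    sympForm lam (ψ z) (mfderiv 𝓘(ℝ, StdSpace (m + 1)) (sympModel m) ψ z v)
      (mfderiv 𝓘(ℝ, StdSpace (m + 1)) (sympModel m) ψ z w) = stdForm v w
  relative : ∀ z ∈ Metric.closedBall (0 : StdSpace (m + 1)) r, ψ z ∈ L ↔ z ∈ realPlane (m + 1)

/-- The open slab `(a, b) × (P × ℝ)` of the symplectization, for extended reals `a` and `b`. -/
def slab (P : Type*) (a b : EReal) : Set (ℝ × (P × ℝ)) :=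
  {x | a < (x.1 : EReal) ∧ (x.1 : EReal) < b}

/-- The part `L_a^b` of `L` in the slab `(a, b) × (P × ℝ)`. -/
def portion (L : Set (ℝ × (P × ℝ))) (a b : EReal) : Set (ℝ × (P × ℝ)) :=
  L ∩ slab P a b

/-- The relative Gromov width `w(L_a^b)`: the supremum, in `[0, ∞]`, of `π r²` over all `r > 0` for
which there is a relative symplectic embedding of `B^{2(m+1)}(r)` into
`((a, b) × (P × ℝ), L_a^b)`. -/
def relWidth (lam : OneForm (𝓡 (2 * m)) P) (L : Set (ℝ × (P × ℝ))) (a b : EReal) : ENNReal :=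
  sSup {A | ∃ r : ℝ, 0 < r ∧ A = ENNReal.ofReal (Real.pi * r ^ 2) ∧
    ∃ ψ, IsRelSymplecticEmbedding lam (slab P a b) (portion L a b) r ψ}

end Symplectization

end

open Set Filter Topology
open scoped Manifold ContDiff

noncomputable section

set_option maxSynthPendingDepth 3

/-! Translation by `σ` in the `s`-direction multiplies `ω = d(e^s α)` by `e^σ` and, for `σ ≥ 0`,
maps the cylindrical positive end of `L` into itself. So a single relative Darboux ball of radius
`r` in that end suffices: translate it by `σ` and precompose with `z ↦ e^{-σ/2} z`. This gives a
relative symplectic ball of radius `e^{σ/2} r`, which for large `σ` lies above any given level `s₀ <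
∞`. Letting `σ → ∞` makes the width infinite (`isRelSymplecticEmbedding_translate`).

The initial ball comes from a Darboux theorem relative to `L`. Since the end lies over a Legendrian,
`β = e^s α` kills the vectors tangent to `L` there; a submanifold chart turns `L` into a linear
subspace `V` on which `β` vanishes (`exists_relative_darboux_chart`). Moser's argument then uses
`ω_t = dβ₀ + t (dβ - dβ₀)`, where `dβ₀` is the value of `dβ` at the origin, and takes as primitive
of `dβ - dβ₀` the form `β` minus its first-order Taylor polynomial. This primitive kills `V` along
`V`, so the Moser field is tangent to the Lagrangian `V` and its flow preserves `V`
(`exists_constant_bilinExtDeriv`); a symplectic basis adapted to `V` finishes.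

The same primitive vanishes to second order at the origin, and so does the Moser field. Smoothness
of its flow in the initial point therefore follows from the inverse function theorem on `C([0,1],
E)`: the integral operator defining the trajectories has the identity as its derivative at the zero
curve (`exists_smooth_flow`). -/

/-! ### Superposition operators on spaces of continuous maps -/

section Superposition

universe u

variable {K : Type*} [TopologicalSpace K] [CompactSpace K]
  {F G : Type u} [NormedAddCommGroup F] [NormedSpace ℝ F] [NormedAddCommGroup G] [NormedSpace ℝ G]

/-- Pointwise application of a continuous family of continuous linear maps to a continuous map. -/
def pointwiseApply : C(K, F →L[ℝ] G) →L[ℝ] C(K, F) →L[ℝ] C(K, G) :=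
  LinearMap.mkContinuous₂
    (LinearMap.mk₂ ℝ (fun (a : C(K, F →L[ℝ] G)) (η : C(K, F)) =>
        (⟨fun t => a t (η t), by fun_prop⟩ : C(K, G)))
      (fun _ _ _ => by ext; simp) (fun _ _ _ => by ext; simp)
      (fun _ _ _ => by ext; simp) (fun _ _ _ => by ext; simp)) 1 (by
    intro a η
    rw [one_mul, ContinuousMap.norm_le _ (by positivity)]
    intro t
    exact ((a t).le_opNorm _).trans
      (mul_le_mul (a.norm_coe_le_norm t) (η.norm_coe_le_norm t) (norm_nonneg _)
        (norm_nonneg a)))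

/-- The map `δ ↦ f' ∘ δ` is continuous for the sup norm, so near `γ` the derivative of `f` varies by
at most `ε` uniformly in `t`; the mean value inequality is then applied pointwise. -/
theorem hasFDerivAt_postcomp {f : F → G} (hf : ContDiff ℝ 1 f) (γ : C(K, F)) :
    HasFDerivAt (fun δ : C(K, F) => (⟨f, hf.continuous⟩ : C(F, G)).comp δ)
      (pointwiseApply ((⟨fderiv ℝ f, hf.continuous_fderiv one_ne_zero⟩ : C(F, F →L[ℝ] G)).comp γ))
      γ := by
  have hc : Continuous fun δ : C(K, F) =>
      (⟨fderiv ℝ f, hf.continuous_fderiv one_ne_zero⟩ : C(F, F →L[ℝ] G)).comp δ :=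
    ContinuousMap.continuous_postcomp _
  rw [hasFDerivAt_iff_isLittleO, Asymptotics.isLittleO_iff]
  intro ε hε
  obtain ⟨r, hr, hball⟩ := Metric.eventually_nhds_iff.1
    ((hc.continuousAt (x := γ)).eventually_mem (Metric.ball_mem_nhds (α := C(K, F →L[ℝ] G)) _ hε))
  filter_upwards [Metric.ball_mem_nhds γ hr] with δ hδ
  rw [ContinuousMap.norm_le _ (by positivity)]
  intro t
  have key : ∀ y ∈ segment ℝ (γ t) (δ t), ‖fderiv ℝ f y - fderiv ℝ f (γ t)‖ ≤ ε := by
    intro y hy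
    rw [segment_eq_image'] at hy
    obtain ⟨θ, hθ, rfl⟩ := hy
    -- A point of the segment is the value at `t` of the curve `γ + θ (δ - γ)`, which stays in the
    -- ball around `γ`.
    have h1 : dist (γ + θ • (δ - γ)) γ < r := by
      rw [dist_eq_norm, add_sub_cancel_left, norm_smul, Real.norm_of_nonneg hθ.1]
      calc θ * ‖δ - γ‖ ≤ 1 * ‖δ - γ‖ := by gcongr; exact hθ.2
        _ < r := by rw [one_mul, ← dist_eq_norm]; exact hδ
    have h2 := hball h1
    rw [← dist_eq_norm]
    exact (ContinuousMap.dist_apply_le_dist t).trans (Metric.mem_ball.1 h2).le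
  have := (convex_segment (𝕜 := ℝ) (γ t) (δ t)).norm_image_sub_le_of_norm_hasFDerivWithin_le'
    (f := f) (f' := fderiv ℝ f) (φ := fderiv ℝ f (γ t))
    (fun y _ => (hf.differentiable one_ne_zero y).hasFDerivAt.hasFDerivWithinAt) key
    (left_mem_segment ℝ _ _) (right_mem_segment ℝ _ _)
  refine this.trans ?_
  gcongr
  exact (δ - γ).norm_coe_le_norm t

/-- The induction runs over all pairs of spaces, since the derivative of `f` takes values in `F
→L[ℝ] G`; the common universe lets this space serve as a new target. -/
theorem contDiff_postcomp_nat (n : ℕ) : ∀ {F G : Type u} [NormedAddCommGroup F] [NormedSpace ℝ F]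
    [NormedAddCommGroup G] [NormedSpace ℝ G] {f : F → G} (hf : ContDiff ℝ n f),
    ContDiff ℝ n (fun γ : C(K, F) => (⟨f, hf.continuous⟩ : C(F, G)).comp γ) := by
  induction n with
  | zero =>
    intro F G _ _ _ _ f hf
    exact contDiff_zero.2 (ContinuousMap.continuous_postcomp _)
  | succ n ih =>
    intro F G _ _ _ _ f hf
    have hf1 : ContDiff ℝ 1 f := hf.of_le (by norm_cast; omega)
    have hf' : ContDiff ℝ n (fderiv ℝ f) := hf.fderiv_right (by norm_cast)
    exact contDiff_succ_iff_hasFDerivAt.2 ⟨_, (pointwiseApply (K := K)).contDiff.comp (ih hf'),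
      hasFDerivAt_postcomp hf1⟩

theorem contDiff_postcomp {f : F → G} (hf : ContDiff ℝ ∞ f) :
    ContDiff ℝ ∞ (fun γ : C(K, F) => (⟨f, hf.continuous⟩ : C(F, G)).comp γ) :=
  contDiff_infty.2 fun n => contDiff_postcomp_nat n (hf.of_le (by exact_mod_cast le_top))

end Superposition

/-! ### Smooth dependence of flows on the initial point -/

section Flow

universe u

/-- The inverse is smooth at each point where the derivative of `f` is invertible. Invertibility is
an open condition, so shrinking the domain gives smoothness on an open set. -/
theorem exists_contDiffOn_localInverse {A B : Type*} [NormedAddCommGroup A] [NormedSpace ℝ A]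
    [CompleteSpace A] [NormedAddCommGroup B] [NormedSpace ℝ B] {f : A → B} (hf : ContDiff ℝ ∞ f)
    {a : A} (e : A ≃L[ℝ] B) (he : HasFDerivAt f (e : A →L[ℝ] B) a) :
    ∃ U : Set B, IsOpen U ∧ f a ∈ U ∧ ∃ g : B → A, ContDiffOn ℝ ∞ g U ∧ g (f a) = a ∧
      ∀ y ∈ U, f (g y) = y := by
  set R := hf.contDiffAt.toOpenPartialHomeomorph f he (by simp) with hR
  have ha : a ∈ R.source := hf.contDiffAt.mem_toOpenPartialHomeomorph_source he (by simp)
  have hRf : (R : A → B) = f := rfl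
  have hopen : IsOpen (fderiv ℝ f ⁻¹' range ((↑) : (A ≃L[ℝ] B) → A →L[ℝ] B)) :=
    ContinuousLinearEquiv.isOpen.preimage (hf.continuous_fderiv (by simp))
  refine ⟨_, R.symm.isOpen_inter_preimage hopen, ⟨R.map_source ha, ?_⟩, R.symm, ?_, ?_, ?_⟩
  · have hinv : R.symm (f a) = a := R.left_inv ha
    rw [mem_preimage, mem_preimage, hinv, he.fderiv]
    exact ⟨e, rfl⟩
  · rintro y ⟨hy, e', he'⟩
    refine (R.contDiffAt_symm (f₀' := e') hy ?_ hf.contDiffAt).contDiffWithinAt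
    rw [he', hRf]
    exact (hf.differentiable (by simp) _).hasFDerivAt
  · exact R.left_inv ha
  · rintro y ⟨hy, -⟩
    exact R.right_inv hy

variable {E : Type u} [NormedAddCommGroup E] [NormedSpace ℝ E]

/-- The primitive vanishing at `0` of a continuous curve parametrized by the unit interval. -/
def primitiveOp [CompleteSpace E] : C(unitInterval, E) →L[ℝ] C(unitInterval, E) :=
  LinearMap.mkContinuous
    { toFun := fun γ => ⟨fun t => ∫ s in (0 : ℝ)..t, γ (projIcc 0 1 zero_le_one s), by
        have : Continuous fun s : ℝ => γ (projIcc 0 1 zero_le_one s) :=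
          γ.continuous.comp continuous_projIcc
        exact (intervalIntegral.continuous_primitive
          (fun a b => this.intervalIntegrable a b) 0).comp continuous_subtype_val⟩
      map_add' := fun γ δ => by
        ext t
        exact intervalIntegral.integral_add
          ((γ.continuous.comp continuous_projIcc).intervalIntegrable _ _)
          ((δ.continuous.comp continuous_projIcc).intervalIntegrable _ _)
      map_smul' := fun c γ => by
        ext t
        exact intervalIntegral.integral_smul _ _ } 1 (by
    intro γ
    rw [one_mul, ContinuousMap.norm_le _ (norm_nonneg _)]
    intro t
    have := intervalIntegral.norm_integral_le_of_norm_le_const (a := (0 : ℝ)) (b := t)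
      (f := fun s => γ (projIcc 0 1 zero_le_one s)) (C := ‖γ‖) fun s _ => γ.norm_coe_le_norm _
    refine this.trans ?_
    rw [sub_zero, abs_of_nonneg t.2.1]
    exact mul_le_of_le_one_right (norm_nonneg _) t.2.2)

/-- The graph of a curve. -/
def curveGraph (γ : C(unitInterval, E)) : C(unitInterval, ℝ × E) :=
  ⟨fun t => ((t : ℝ), γ t), by fun_prop⟩

theorem curveGraph_eq (γ : C(unitInterval, E)) :
    curveGraph γ = (⟨fun t => ((t : ℝ), 0), by fun_prop⟩ : C(unitInterval, ℝ × E)) +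
      (ContinuousLinearMap.inr ℝ ℝ E).compLeftContinuous ℝ unitInterval γ := by
  ext t <;> simp [curveGraph]

theorem contDiff_curveGraph : ContDiff ℝ ∞ (curveGraph (E := E)) := by
  rw [show curveGraph (E := E) = _ from funext curveGraph_eq]
  exact contDiff_const.add (ContinuousLinearMap.contDiff _)

theorem hasFDerivAt_curveGraph (γ : C(unitInterval, E)) :
    HasFDerivAt curveGraph ((ContinuousLinearMap.inr ℝ ℝ E).compLeftContinuous ℝ unitInterval)
      γ := by
  rw [show curveGraph (E := E) = _ from funext curveGraph_eq]
  exact (ContinuousLinearMap.hasFDerivAt _).const_add _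

variable [CompleteSpace E]

/-- The operator `γ ↦ γ - ∫ X(s, γ(s)) ds`, whose level sets over constants are the integral curves
of the time-dependent vector field `X`. -/
def integralDefect {X : ℝ × E → E} (hX : ContDiff ℝ ∞ X) (γ : C(unitInterval, E)) :
    C(unitInterval, E) :=
  γ - primitiveOp ((⟨X, hX.continuous⟩ : C(ℝ × E, E)).comp (curveGraph γ))

theorem integralDefect_apply {X : ℝ × E → E} (hX : ContDiff ℝ ∞ X) (γ : C(unitInterval, E))
    (t : unitInterval) :
    integralDefect hX γ t = γ t - ∫ s in (0 : ℝ)..t,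
      X ((projIcc (0 : ℝ) 1 zero_le_one s : ℝ), γ (projIcc 0 1 zero_le_one s)) := rfl

theorem contDiff_integralDefect {X : ℝ × E → E} (hX : ContDiff ℝ ∞ X) :
    ContDiff ℝ ∞ (integralDefect hX) :=
  contDiff_id.sub ((primitiveOp (E := E)).contDiff.comp
    ((contDiff_postcomp hX).comp contDiff_curveGraph))

/-- The derivative of `integralDefect`. -/
def integralDefectDeriv {X : ℝ × E → E} (hX : ContDiff ℝ ∞ X) (γ : C(unitInterval, E)) :
    C(unitInterval, E) →L[ℝ] C(unitInterval, E) :=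
  ContinuousLinearMap.id ℝ _ - primitiveOp.comp ((pointwiseApply
    ((⟨fderiv ℝ X, hX.continuous_fderiv (by simp)⟩ : C(ℝ × E, ℝ × E →L[ℝ] E)).comp
      (curveGraph γ))).comp ((ContinuousLinearMap.inr ℝ ℝ E).compLeftContinuous ℝ unitInterval))

theorem integralDefectDeriv_apply {X : ℝ × E → E} (hX : ContDiff ℝ ∞ X)
    (γ η : C(unitInterval, E)) (t : unitInterval) :
    integralDefectDeriv hX γ η t = η t - ∫ s in (0 : ℝ)..t,
      fderiv ℝ X ((projIcc (0 : ℝ) 1 zero_le_one s : ℝ), γ (projIcc 0 1 zero_le_one s))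
        (0, η (projIcc 0 1 zero_le_one s)) := rfl

theorem hasFDerivAt_integralDefect {X : ℝ × E → E} (hX : ContDiff ℝ ∞ X)
    (γ : C(unitInterval, E)) :
    HasFDerivAt (integralDefect hX) (integralDefectDeriv hX γ) γ :=
  (hasFDerivAt_id γ).sub ((primitiveOp (E := E)).hasFDerivAt.comp γ
    ((hasFDerivAt_postcomp (hX.of_le (by simp)) (curveGraph γ)).comp γ (hasFDerivAt_curveGraph γ)))

/-- A curve satisfying the integral equation on `[0, 1]` has the expected derivative. -/
theorem hasDerivAt_integralCurve {f : unitInterval → E} (hf : Continuous f) {x : E}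
    {g : ℝ → E} (hg : ∀ t ∈ Icc (0 : ℝ) 1, g t = x + ∫ s in (0 : ℝ)..t,
      f (projIcc 0 1 zero_le_one s)) :
    g 0 = x ∧ ∀ t (ht : t ∈ Icc (0 : ℝ) 1), HasDerivWithinAt g (f ⟨t, ht⟩) (Icc 0 1) t := by
  -- `projIcc` extends the integrand continuously to `ℝ`, so the fundamental theorem of calculus
  -- also covers the endpoints.
  have hc : Continuous fun s : ℝ => f (projIcc 0 1 zero_le_one s) := hf.comp continuous_projIcc
  have hd : ∀ t : ℝ, HasDerivAt (fun t => x + ∫ s in (0 : ℝ)..t, f (projIcc 0 1 zero_le_one s))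
      (f (projIcc 0 1 zero_le_one t)) t := fun t =>
    (intervalIntegral.integral_hasDerivAt_right (hc.intervalIntegrable _ _)
      (hc.stronglyMeasurableAtFilter _ _) hc.continuousAt).const_add x
  refine ⟨by simp [hg 0 (by simp)], fun t ht => ?_⟩
  have h1 := (hd t).hasDerivWithinAt.congr hg (hg t ht)
  rwa [projIcc_of_mem zero_le_one ht] at h1

/-- The flow on `[0, 1]` of a time-dependent vector field that vanishes to second order at the
origin is defined near the origin and smooth, and its derivative solves the linearized equation. -/
theorem exists_smooth_flow {X : ℝ × E → E} (hX : ContDiff ℝ ∞ X) (hX0 : ∀ t, X (t, 0) = 0)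
    (hX1 : ∀ t v, fderiv ℝ X (t, 0) (0, v) = 0) :
    ∃ U : Set E, IsOpen U ∧ 0 ∈ U ∧ ∃ Φ : ℝ → E → E,
      (∀ t ∈ Icc (0 : ℝ) 1, ContDiffOn ℝ ∞ (Φ t) U) ∧
      (∀ ε > 0, ∀ᶠ x in 𝓝 (0 : E), ∀ t ∈ Icc (0 : ℝ) 1, ‖Φ t x‖ < ε) ∧
      (∀ x ∈ U, Φ 0 x = x ∧ ∀ t ∈ Icc (0 : ℝ) 1,
        HasDerivWithinAt (fun t => Φ t x) (X (t, Φ t x)) (Icc 0 1) t) ∧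
      (∀ x ∈ U, ∀ v, fderiv ℝ (Φ 0) x v = v ∧ ∀ t ∈ Icc (0 : ℝ) 1,
        HasDerivWithinAt (fun t => fderiv ℝ (Φ t) x v)
          (fderiv ℝ X (t, Φ t x) (0, fderiv ℝ (Φ t) x v)) (Icc 0 1) t) := by
  have hH0 : integralDefect hX 0 = 0 := by
    ext t
    simp [integralDefect_apply, hX0]
  -- The spatial derivative of `X` vanishes along the zero curve, so the linearization there is the
  -- identity and no short-time estimate is needed to invert it.
  have hD0 : integralDefectDeriv hX 0 = ContinuousLinearMap.id ℝ _ := by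
    ext η t
    simp [integralDefectDeriv_apply, hX1]
  obtain ⟨U₀, hU₀, h0U₀, g, hg, hg0, hgU⟩ := exists_contDiffOn_localInverse
    (contDiff_integralDefect hX) (a := 0) (ContinuousLinearEquiv.refl ℝ _)
    (by simpa [hD0] using hasFDerivAt_integralDefect hX 0)
  rw [hH0] at h0U₀ hg0
  set c : E →L[ℝ] C(unitInterval, E) := ContinuousLinearMap.const ℝ unitInterval with hcdef
  have hcapp : ∀ x t, c x t = x := fun x t => rfl
  set U : Set E := c ⁻¹' U₀ with hUdef
  have hU : IsOpen U := hU₀.preimage c.continuous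
  have h0U : (0 : E) ∈ U := by simpa [hUdef] using h0U₀
  have hG : ContDiffOn ℝ ∞ (fun x => g (c x)) U := hg.comp c.contDiff.contDiffOn fun x hx => hx
  have hGd : ∀ x ∈ U, HasFDerivAt (fun x => g (c x)) (fderiv ℝ (fun x => g (c x)) x) x :=
    fun x hx => ((hG.contDiffAt (hU.mem_nhds hx)).differentiableAt (by simp)).hasFDerivAt
  -- `g (c x)` is the whole trajectory issuing from `x`; evaluation at a time is linear and
  -- continuous, so smoothness in `x` is inherited from `g`.
  set Φ : ℝ → E → E := fun t x => g (c x) (projIcc 0 1 zero_le_one t) with hΦ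
  have hΦI : ∀ (t : ℝ) (ht : t ∈ Icc (0 : ℝ) 1) x, Φ t x = g (c x) ⟨t, ht⟩ := fun t ht x => by
    simp only [hΦ, projIcc_of_mem zero_le_one ht]
  have hev : ∀ t : unitInterval, ContDiff ℝ ∞ fun γ : C(unitInterval, E) => γ t := fun t =>
    (ContinuousMap.evalCLM ℝ t : C(unitInterval, E) →L[ℝ] E).contDiff
  have hΦ' : ∀ x ∈ U, ∀ t v, fderiv ℝ (Φ t) x v =
      fderiv ℝ (fun x => g (c x)) x v (projIcc 0 1 zero_le_one t) := fun x hx t v => by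
    have := ((ContinuousMap.evalCLM ℝ (projIcc 0 1 zero_le_one t) :
      C(unitInterval, E) →L[ℝ] E).hasFDerivAt).comp x (hGd x hx)
    have h2 : HasFDerivAt (Φ t) _ x := this
    rw [h2.fderiv]
    rfl
  have hcurve : ∀ x ∈ U, ∀ t : unitInterval, g (c x) t = x + ∫ s in (0 : ℝ)..t,
      X ((projIcc (0 : ℝ) 1 zero_le_one s : ℝ), g (c x) (projIcc 0 1 zero_le_one s)) := by
    intro x hx t
    have h1 := congrArg (fun γ : C(unitInterval, E) => γ t) (hgU (c x) hx)
    simp only [integralDefect_apply, hcapp] at h1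
    exact sub_eq_iff_eq_add.1 h1
  have hlin : ∀ x ∈ U, ∀ v, ∀ t : unitInterval, fderiv ℝ (fun x => g (c x)) x v t =
      v + ∫ s in (0 : ℝ)..t,
      fderiv ℝ X ((projIcc (0 : ℝ) 1 zero_le_one s : ℝ), g (c x) (projIcc 0 1 zero_le_one s))
        (0, fderiv ℝ (fun x => g (c x)) x v (projIcc 0 1 zero_le_one s)) := by
    intro x hx v t
    -- Differentiating `integralDefect hX (g (c x)) = c x` in `x` yields the linearized integral
    -- equation.
    have h1 := (hasFDerivAt_integralDefect hX (g (c x))).comp x (hGd x hx)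
    have h2 : HasFDerivAt (fun x => integralDefect hX (g (c x))) c x :=
      c.hasFDerivAt.congr_of_eventuallyEq
        (by filter_upwards [hU.mem_nhds hx] with y hy using hgU (c y) hy)
    have h3 := congrArg (fun A : E →L[ℝ] C(unitInterval, E) => A v t) (h1.unique h2)
    simp only [ContinuousLinearMap.comp_apply, integralDefectDeriv_apply, hcapp] at h3
    exact sub_eq_iff_eq_add.1 h3
  refine ⟨U, hU, h0U, Φ, ?_, ?_, ?_, ?_⟩
  · intro t _
    exact (hev _).comp_contDiffOn hG
  · intro ε hε
    have hcont : ContinuousAt (fun x => g (c x)) 0 := (hG.contDiffAt (hU.mem_nhds h0U)).continuousAt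
    have h1 := hcont.eventually_mem (Metric.ball_mem_nhds _ hε)
    filter_upwards [h1] with x hx t _
    rw [map_zero, hg0, mem_ball_zero_iff] at hx
    exact ((g (c x)).norm_coe_le_norm _).trans_lt hx
  · intro x hx
    have := hasDerivAt_integralCurve (f := fun t => X ((t : ℝ), g (c x) t)) (x := x)
      (g := fun t => Φ t x)
      (hX.continuous.comp (continuous_subtype_val.prodMk (g (c x)).continuous))
      (fun t ht => by rw [hΦI t ht, hcurve x hx])
    refine ⟨this.1, fun t ht => ?_⟩
    rw [hΦI t ht]
    exact this.2 t ht
  · intro x hx v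
    have := hasDerivAt_integralCurve (f := fun t => fderiv ℝ X ((t : ℝ), g (c x) t)
        (0, fderiv ℝ (fun x => g (c x)) x v t)) (x := v)
      (g := fun t => fderiv ℝ (Φ t) x v)
      (((hX.continuous_fderiv (by simp)).comp
        (continuous_subtype_val.prodMk (g (c x)).continuous)).clm_apply
        (continuous_const.prodMk (map_continuous _)))
      (fun t ht => by rw [hΦ' x hx, projIcc_of_mem zero_le_one ht, hlin x hx])
    refine ⟨this.1, fun t ht => ?_⟩
    rw [hΦI t ht, hΦ' x hx t, projIcc_of_mem zero_le_one ht]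
    exact this.2 t ht

end Flow

/-! ### Moser's argument relative to a Lagrangian subspace -/

section Moser

universe u

variable {E : Type u} [NormedAddCommGroup E] [NormedSpace ℝ E]

variable (E) in
/-- Twice the antisymmetrization of a bilinear form. -/
def antisymmetrize : (E →L[ℝ] E →L[ℝ] ℝ) →L[ℝ] E →L[ℝ] E →L[ℝ] ℝ :=
  ContinuousLinearMap.id ℝ _ -
    ((ContinuousLinearMap.flipₗᵢ ℝ E E ℝ).toContinuousLinearEquiv :
      (E →L[ℝ] E →L[ℝ] ℝ) →L[ℝ] E →L[ℝ] E →L[ℝ] ℝ)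

@[simp]
theorem antisymmetrize_apply (B : E →L[ℝ] E →L[ℝ] ℝ) (v w : E) :
    antisymmetrize E B v w = B v w - B w v := rfl

/-- The exterior derivative of a one-form on a normed space, as a bilinear form. -/
def bilinExtDeriv (β : E → E →L[ℝ] ℝ) (x : E) : E →L[ℝ] E →L[ℝ] ℝ :=
  antisymmetrize E (fderiv ℝ β x)

theorem bilinExtDeriv_apply (β : E → E →L[ℝ] ℝ) (x v w : E) :
    bilinExtDeriv β x v w = fderiv ℝ β x v w - fderiv ℝ β x w v := rfl

/-- The linear interpolation between the exterior derivative of `β` at the origin and the exterior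
derivative of `β`. -/
def moserForm (β : E → E →L[ℝ] ℝ) (t : ℝ) (x : E) : E →L[ℝ] E →L[ℝ] ℝ :=
  bilinExtDeriv β 0 + t • (bilinExtDeriv β x - bilinExtDeriv β 0)

theorem moserForm_neg_swap (β : E → E →L[ℝ] ℝ) (t : ℝ) (x v w : E) :
    moserForm β t x v w = -moserForm β t x w v := by
  simp only [moserForm, bilinExtDeriv, add_apply,
    smul_apply, sub_apply, antisymmetrize_apply,
    smul_eq_mul]
  ring

@[simp]
theorem moserForm_zero_right (β : E → E →L[ℝ] ℝ) (t : ℝ) :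
    moserForm β t 0 = bilinExtDeriv β 0 := by
  ext v w
  simp [moserForm]

theorem contDiffOn_fderiv_of_isOpen {G : Type*} [NormedAddCommGroup G] [NormedSpace ℝ G]
    {β : E → G} {W : Set E} (hW : IsOpen W)
    (hβ : ContDiffOn ℝ ∞ β W) : ContDiffOn ℝ ∞ (fderiv ℝ β) W :=
  hβ.fderiv_of_isOpen hW (by simp)

theorem contDiffOn_moserForm {β : E → E →L[ℝ] ℝ} {W : Set E} (hW : IsOpen W)
    (hβ : ContDiffOn ℝ ∞ β W) :
    ContDiffOn ℝ ∞ (fun p : ℝ × E => moserForm β p.1 p.2) (univ ×ˢ W) := by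
  have h0 : ContDiffOn ℝ ∞ (fun p : ℝ × E => fderiv ℝ β p.2) (univ ×ˢ W) :=
    (contDiffOn_fderiv_of_isOpen hW hβ).comp contDiff_snd.contDiffOn fun p hp => hp.2
  have h1 : ContDiffOn ℝ ∞ (fun p : ℝ × E => bilinExtDeriv β p.2) (univ ×ˢ W) :=
    (ContinuousLinearMap.contDiff (E := E →L[ℝ] E →L[ℝ] ℝ) (F := E →L[ℝ] E →L[ℝ] ℝ)
      (antisymmetrize E)).comp_contDiffOn h0
  exact contDiffOn_const.add (contDiff_fst.contDiffOn.smul (h1.sub contDiffOn_const))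

/-- If `β` vanishes on vectors tangent to `V` along `V`, then `V` is isotropic for its exterior
derivative. -/
theorem fderiv_apply_eq_zero_of_subspace {β : E → E →L[ℝ] ℝ} {W : Set E} (hW : IsOpen W)
    (hβ : ContDiffOn ℝ ∞ β W) {V : Submodule ℝ E}
    (hV : ∀ x ∈ W, x ∈ V → ∀ v ∈ V, β x v = 0) {x : E} (hx : x ∈ W) (hxV : x ∈ V) {u v : E}
    (hu : u ∈ V) (hv : v ∈ V) : fderiv ℝ β x u v = 0 := by
  have h1 : HasFDerivAt β (fderiv ℝ β x) x :=
    ((hβ.contDiffAt (hW.mem_nhds hx)).differentiableAt (by simp)).hasFDerivAt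
  have h2 : HasDerivAt (fun t : ℝ => x + t • u) u 0 := by
    simpa using ((hasDerivAt_id (0 : ℝ)).smul_const u).const_add x
  have h3 : HasDerivAt (fun t : ℝ => β (x + t • u) v) (fderiv ℝ β x u v) 0 := by
    have h4 : HasDerivAt (fun t : ℝ => β (x + t • u)) (fderiv ℝ β x u) 0 :=
      HasFDerivAt.comp_hasDerivAt_of_eq 0 h1 h2 (by simp)
    exact (ContinuousLinearMap.apply ℝ ℝ v).hasFDerivAt.comp_hasDerivAt 0 h4
  have h5 : (fun t : ℝ => β (x + t • u) v) =ᶠ[𝓝 0] fun _ => 0 := by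
    have : ∀ᶠ t in 𝓝 (0 : ℝ), x + t • u ∈ W :=
      h2.continuousAt.eventually_mem (by simpa using hW.mem_nhds hx)
    filter_upwards [this] with t ht
    exact hV _ ht (V.add_mem hxV (V.smul_mem t hu)) v hv
  exact h3.unique ((hasDerivAt_const 0 0).congr_of_eventuallyEq h5)

theorem moserForm_eq_zero_of_subspace {β : E → E →L[ℝ] ℝ} {W : Set E} (hW : IsOpen W)
    (h0 : (0 : E) ∈ W) (hβ : ContDiffOn ℝ ∞ β W) {V : Submodule ℝ E}
    (hV : ∀ x ∈ W, x ∈ V → ∀ v ∈ V, β x v = 0) (t : ℝ) {x : E} (hx : x ∈ W) (hxV : x ∈ V)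
    {u v : E} (hu : u ∈ V) (hv : v ∈ V) : moserForm β t x u v = 0 := by
  have key := fun {x} hx hxV {u v} hu hv =>
    fderiv_apply_eq_zero_of_subspace (x := x) (u := u) (v := v) hW hβ hV hx hxV hu hv
  simp [moserForm, bilinExtDeriv, key h0 V.zero_mem hu hv, key h0 V.zero_mem hv hu,
    key hx hxV hu hv, key hx hxV hv hu]

variable [FiniteDimensional ℝ E]

/-- A half-dimensional isotropic subspace is its own orthogonal complement. -/
theorem mem_of_lagrangian {A : E →L[ℝ] E →L[ℝ] ℝ} (hA : ∀ v, (∀ w, A v w = 0) → v = 0)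
    {V : Submodule ℝ E} (hdim : 2 * Module.finrank ℝ V = Module.finrank ℝ E)
    (hV : ∀ u ∈ V, ∀ v ∈ V, A u v = 0) {y : E} (hy : ∀ v ∈ V, A y v = 0) : y ∈ V := by
  set a : E →ₗ[ℝ] Module.Dual ℝ E := (ContinuousLinearMap.coeLM ℝ).comp A.toLinearMap with ha
  have hainj : Function.Injective a := by
    rw [← LinearMap.ker_eq_bot, LinearMap.ker_eq_bot']
    exact fun v hv => hA v fun w => LinearMap.congr_fun hv w
  -- `A` embeds `V` into its annihilator, which has dimension `dim E - dim V = dim V`, so the image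
  -- is the whole annihilator.
  have hle : V.map a ≤ V.dualAnnihilator := by
    rintro _ ⟨u, hu, rfl⟩
    rw [Submodule.mem_dualAnnihilator]
    exact fun v hv => hV u hu v hv
  have hfin := Subspace.finrank_add_finrank_dualAnnihilator_eq V
  have heq : V.map a = V.dualAnnihilator := by
    refine Submodule.eq_of_le_of_finrank_eq hle ?_
    rw [(Submodule.equivMapOfInjective a hainj V).symm.finrank_eq]
    omega
  have hy' : a y ∈ V.map a := by
    rw [heq, Submodule.mem_dualAnnihilator]
    exact hy
  obtain ⟨u, hu, huy⟩ := hy'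
  exact hainj huy ▸ hu

/-- Invertibility is phrased as membership in the range of the equivalences because that set is open
and operator inversion is smooth at its points. -/
theorem isInvertible_of_nondegenerate {A : E →L[ℝ] E →L[ℝ] ℝ}
    (hA : ∀ v, (∀ w, A v w = 0) → v = 0) :
    A ∈ range ((↑) : (E ≃L[ℝ] (E →L[ℝ] ℝ)) → E →L[ℝ] E →L[ℝ] ℝ) := by
  have hinj : Function.Injective A.toLinearMap := by
    rw [← LinearMap.ker_eq_bot, LinearMap.ker_eq_bot']
    exact fun v hv => hA v fun w => DFunLike.congr_fun hv w
  have hfin : Module.finrank ℝ E = Module.finrank ℝ (E →L[ℝ] ℝ) := by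
    rw [← (LinearMap.toContinuousLinearMap (𝕜 := ℝ) (E := E) (F' := ℝ)).finrank_eq]
    exact Subspace.dual_finrank_eq.symm
  refine ⟨(LinearEquiv.ofInjectiveOfFinrankEq A.toLinearMap hinj hfin).toContinuousLinearEquiv, ?_⟩
  ext v w
  rfl

/-- A smooth cutoff function around `[0, 1] × {0}`. -/
theorem exists_cutoff {Ω : Set (ℝ × E)} (hΩ : IsOpen Ω) (h0 : ∀ t, (t, (0 : E)) ∈ Ω) :
    ∃ χ : ℝ × E → ℝ, ContDiff ℝ ∞ χ ∧ HasCompactSupport χ ∧ tsupport χ ⊆ Ω ∧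
      ∃ r > 0, ∀ t ∈ Icc (0 : ℝ) 1, ∀ x : E, ‖x‖ < r → (t, x) ∈ Ω ∧ χ (t, x) = 1 := by
  -- The time bump below equals 1 on `[-1/2, 3/2]`, which contains `[0, 1]`, and is supported in
  -- `[-3/2, 5/2]`, inside `[-2, 3]`.
  obtain ⟨u, v, -, hv, hu, h0v, huv⟩ := generalized_tube_lemma (s := Icc (-2 : ℝ) 3)
    isCompact_Icc (t := {(0 : E)}) isCompact_singleton hΩ
    (by rintro ⟨t, x⟩ ⟨-, rfl⟩; exact h0 t)
  obtain ⟨r, hr, hrv⟩ := Metric.isOpen_iff.1 hv 0 (h0v rfl)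
  let b₁ : ContDiffBump (1 / 2 : ℝ) := ⟨1, 2, by norm_num, by norm_num⟩
  let b₂ : ContDiffBump (0 : E) := ⟨r / 4, r / 2, by positivity, by linarith⟩
  have hsub : Function.support (fun p : ℝ × E => b₁ p.1 * b₂ p.2) ⊆
      Metric.closedBall (1 / 2 : ℝ) 2 ×ˢ Metric.closedBall (0 : E) (r / 2) := by
    intro p hp
    have h1 : p.1 ∈ Function.support b₁ := left_ne_zero_of_mul hp
    have h2 : p.2 ∈ Function.support b₂ := right_ne_zero_of_mul hp
    rw [b₁.support_eq] at h1
    rw [b₂.support_eq] at h2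
    exact ⟨Metric.ball_subset_closedBall h1, Metric.ball_subset_closedBall h2⟩
  have hcpt : IsCompact (Metric.closedBall (1 / 2 : ℝ) 2 ×ˢ Metric.closedBall (0 : E) (r / 2)) :=
    (isCompact_closedBall _ _).prod (isCompact_closedBall _ _)
  have hts : tsupport (fun p : ℝ × E => b₁ p.1 * b₂ p.2) ⊆
      Metric.closedBall (1 / 2 : ℝ) 2 ×ˢ Metric.closedBall (0 : E) (r / 2) :=
    closure_minimal hsub hcpt.isClosed
  have hin : Metric.closedBall (1 / 2 : ℝ) 2 ×ˢ Metric.closedBall (0 : E) (r / 2) ⊆ Ω := by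
    rintro ⟨t, x⟩ ⟨ht, hx⟩
    refine huv ⟨hu ?_, hrv ?_⟩
    · rw [Real.closedBall_eq_Icc] at ht
      exact ⟨by linarith [ht.1], by linarith [ht.2]⟩
    · exact Metric.closedBall_subset_ball (by linarith) hx
  refine ⟨fun p => b₁ p.1 * b₂ p.2,
    (b₁.contDiff.comp contDiff_fst).mul (b₂.contDiff.comp contDiff_snd),
    HasCompactSupport.of_support_subset_isCompact hcpt hsub, hts.trans hin, r / 4, by positivity,
    fun t ht x hx => ?_⟩
  have ht' : t ∈ Metric.closedBall (1 / 2 : ℝ) 1 := by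
    rw [Real.closedBall_eq_Icc]
    exact ⟨by linarith [ht.1], by linarith [ht.2]⟩
  have hx' : x ∈ Metric.closedBall (0 : E) (r / 4) := by simpa using hx.le
  refine ⟨hin ⟨Metric.closedBall_subset_closedBall (by norm_num) ht',
    Metric.closedBall_subset_closedBall (by linarith) hx'⟩, ?_⟩
  simp only [b₁.one_of_mem_closedBall ht', b₂.one_of_mem_closedBall hx', mul_one]

/-- The vector field of Moser's argument, cut off away from the origin. -/
theorem exists_moser_field {β : E → E →L[ℝ] ℝ} {W : Set E} (hW : IsOpen W) (h0 : (0 : E) ∈ W)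
    (hβ : ContDiffOn ℝ ∞ β W) (hnd : ∀ v, (∀ w, bilinExtDeriv β 0 v w = 0) → v = 0)
    {V : Submodule ℝ E} (hdim : 2 * Module.finrank ℝ V = Module.finrank ℝ E)
    (hV : ∀ x ∈ W, x ∈ V → ∀ v ∈ V, β x v = 0) :
    ∃ X : ℝ × E → E, ContDiff ℝ ∞ X ∧ HasCompactSupport X ∧ (∀ t, X (t, 0) = 0) ∧
      (∀ t v, fderiv ℝ X (t, 0) (0, v) = 0) ∧ (∀ t, ∀ x ∈ V, X (t, x) ∈ V) ∧
      ∃ r > 0, ∀ x, ‖x‖ < r → x ∈ W ∧ ∀ t ∈ Icc (0 : ℝ) 1,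
        moserForm β t x (X (t, x)) = -(β x - β 0 - fderiv ℝ β 0 x) := by
  set inv := ContinuousLinearMap.inverse (R := ℝ) (M := E) (M₂ := E →L[ℝ] ℝ) with hinv
  -- The open set where `ω_t` is invertible; it contains `ℝ × {0}` because `ω_t` at the origin does
  -- not depend on `t`.
  set Ω : Set (ℝ × E) := (univ ×ˢ W) ∩ (fun p : ℝ × E => moserForm β p.1 p.2) ⁻¹'
    range ((↑) : (E ≃L[ℝ] (E →L[ℝ] ℝ)) → E →L[ℝ] E →L[ℝ] ℝ) with hΩdef
  have hΩ : IsOpen Ω := (contDiffOn_moserForm hW hβ).continuousOn.isOpen_inter_preimage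
    (isOpen_univ.prod hW) ContinuousLinearEquiv.isOpen
  have h0Ω : ∀ t, (t, (0 : E)) ∈ Ω := fun t =>
    ⟨⟨mem_univ _, h0⟩, by simpa only [mem_preimage, moserForm_zero_right] using
      isInvertible_of_nondegenerate hnd⟩
  obtain ⟨χ, hχ, hχc, hχΩ, r, hr, hχ1⟩ := exists_cutoff hΩ h0Ω
  -- The one-form `x ↦ Dβ(0) x` has constant exterior derivative `dβ₀`, so `σ` is a primitive of `dβ
  -- - dβ₀`; both `σ` and its derivative vanish at the origin.
  set σ : E → E →L[ℝ] ℝ := fun x => β x - β 0 - fderiv ℝ β 0 x with hσdef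
  have hσ : ContDiffOn ℝ ∞ σ W :=
    (hβ.sub contDiffOn_const).sub (fderiv ℝ β 0).contDiff.contDiffOn
  have hσV : ∀ x ∈ W, x ∈ V → ∀ v ∈ V, σ x v = 0 := fun x hx hxV v hv => by
    simp [hσdef, hV x hx hxV v hv, hV 0 h0 V.zero_mem v hv,
      fderiv_apply_eq_zero_of_subspace hW hβ hV h0 V.zero_mem hxV hv]
  have hσd : HasFDerivAt σ (0 : E →L[ℝ] E →L[ℝ] ℝ) 0 := by
    have h1 : HasFDerivAt β (fderiv ℝ β 0) 0 :=
      ((hβ.contDiffAt (hW.mem_nhds h0)).differentiableAt (by simp)).hasFDerivAt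
    have h2 := (h1.sub_const (β 0)).sub (fderiv ℝ β 0).hasFDerivAt
    rw [sub_self] at h2
    exact h2
  set Y : ℝ × E → E := fun p => -(inv (moserForm β p.1 p.2) (σ p.2)) with hYdef
  have hinvC : ContDiffOn ℝ ∞ (fun p : ℝ × E => inv (moserForm β p.1 p.2)) Ω := by
    rintro p ⟨hp, e, he⟩
    have h1 : ContDiffAt ℝ ∞ inv (moserForm β p.1 p.2) := by
      simp only at he
      rw [← he]
      exact contDiffAt_map_inverse e
    exact (h1.comp p ((contDiffOn_moserForm hW hβ).contDiffAt
      ((isOpen_univ.prod hW).mem_nhds hp))).contDiffWithinAt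
  have hY : ContDiffOn ℝ ∞ Y Ω :=
    (hinvC.clm_apply (hσ.comp contDiff_snd.contDiffOn fun p hp => hp.1.2)).neg
  have hYeq : ∀ p ∈ Ω, moserForm β p.1 p.2 (Y p) = -σ p.2 := by
    rintro p ⟨hp, e, he⟩
    simp only [hYdef, ← he, hinv, ContinuousLinearMap.inverse_equiv, map_neg]
    simp
  -- Along `V` the form `σ` kills `V`, so `Y` is `ω_t`-orthogonal to `V`; as `V` is Lagrangian for
  -- `ω_t`, it contains `Y`.
  have hYV : ∀ p ∈ Ω, p.2 ∈ V → Y p ∈ V := by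
    intro p hp hpV
    refine mem_of_lagrangian (A := moserForm β p.1 p.2) ?_ hdim
      (fun u hu v hv => moserForm_eq_zero_of_subspace hW h0 hβ hV _ hp.1.2 hpV hu hv) ?_
    · intro v hv
      obtain ⟨e, he⟩ := hp.2
      simp only at he
      rw [← he] at hv
      exact e.injective (by ext w; simpa using hv w)
    · intro v hv
      rw [hYeq p hp, neg_apply, hσV _ hp.1.2 hpV v hv, neg_zero]
  have hX : ContDiff ℝ ∞ fun p => χ p • Y p := by
    rw [contDiff_iff_contDiffAt]
    intro p
    by_cases hp : p ∈ tsupport χ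
    · exact hχ.contDiffAt.smul (hY.contDiffAt (hΩ.mem_nhds (hχΩ hp)))
    · refine (contDiffAt_const (c := (0 : E))).congr_of_eventuallyEq ?_
      filter_upwards [(isClosed_tsupport χ).isOpen_compl.mem_nhds hp] with q hq
      rw [image_eq_zero_of_notMem_tsupport hq, zero_smul]
  refine ⟨fun p => χ p • Y p, hX, hχc.smul_right, ?_, ?_, ?_, r, hr, ?_⟩
  · intro t
    simp [hYdef, hσdef]
  · intro t v
    -- By the product rule every term of the derivative contains a factor `σ(0) = 0` or `Dσ(0) = 0`.
    have h1 : HasFDerivAt (fun p : ℝ × E => inv (moserForm β p.1 p.2)) _ (t, 0) :=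
      ((hinvC.contDiffAt (hΩ.mem_nhds (h0Ω t))).differentiableAt (by simp)).hasFDerivAt
    have h2 : HasFDerivAt (fun p : ℝ × E => σ p.2) ((0 : E →L[ℝ] E →L[ℝ] ℝ).comp
      (ContinuousLinearMap.snd ℝ ℝ E)) (t, 0) :=
      HasFDerivAt.comp (g := σ) (f := Prod.snd) (t, (0 : E)) hσd hasFDerivAt_snd
    have h3 := ((hχ.differentiable (by simp) (t, 0)).hasFDerivAt).smul (h1.clm_apply h2).neg
    have h4 : HasFDerivAt (fun p => χ p • Y p) _ (t, 0) := h3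
    rw [h4.fderiv]
    simp [hσdef]
  · intro t x hx
    by_cases hp : (t, x) ∈ tsupport χ
    · exact V.smul_mem _ (hYV _ (hχΩ hp) hx)
    · simp only [image_eq_zero_of_notMem_tsupport hp, zero_smul, V.zero_mem]
  · intro x hx
    refine ⟨(hχ1 0 (by simp) x hx).1.1.2, fun t ht => ?_⟩
    simp only [(hχ1 t ht x hx).2, one_smul]
    exact hYeq _ (hχ1 t ht x hx).1

end Moser

/-! ### Flow of the Moser field and the relative Darboux theorem -/

section RelativeDarboux

universe u

variable {E : Type u} [NormedAddCommGroup E] [NormedSpace ℝ E] [FiniteDimensional ℝ E]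

/-- The integral curves of a Lipschitz vector field tangent to a subspace stay in the subspace or
in its complement. -/
theorem mem_subspace_iff_of_integralCurve {X : ℝ × E → E} {C : NNReal} (hX : LipschitzWith C X)
    {V : Submodule ℝ E} (hXV : ∀ t, ∀ x ∈ V, X (t, x) ∈ V) {y : ℝ → E}
    (hy : ∀ t ∈ Icc (0 : ℝ) 1, HasDerivWithinAt y (X (t, y t)) (Icc 0 1) t) :
    y 1 ∈ V ↔ y 0 ∈ V := by
  obtain ⟨V', hV'⟩ := V.exists_isCompl
  set q : E →L[ℝ] E := LinearMap.toContinuousLinearMap (V'.projection V hV'.symm) with hq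
  have hq0 : ∀ x, q x = 0 ↔ x ∈ V := fun x => by
    rw [hq, LinearMap.coe_toContinuousLinearMap', ← LinearMap.mem_ker, Submodule.ker_projection]
  have hqV : ∀ x, x - q x ∈ V := fun x => by
    rw [← hq0, map_sub, sub_eq_zero, hq]
    exact (DFunLike.congr_fun (Submodule.isIdempotentElem_projection hV'.symm).eq x).symm
  -- `q` has kernel `V`. The transverse part `q (y t)` solves the ODE `z' = v t z`, and so does `0`
  -- because `y t - q (y t)` lies in `V`; uniqueness forwards and backwards in time gives the two
  -- implications.
  set v : ℝ → E → E := fun t z => q (X (t, y t - q (y t) + z)) with hv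
  have hvL : ∀ t, LipschitzWith (‖q‖₊ * (C * 1)) (v t) := fun t => by
    refine q.lipschitz.comp (hX.comp ?_)
    refine LipschitzWith.of_dist_le_mul fun a b => ?_
    simp [Prod.dist_eq]
  have hw : ∀ t ∈ Icc (0 : ℝ) 1, HasDerivWithinAt (fun t => q (y t)) (v t (q (y t))) (Icc 0 1) t :=
    fun t ht => by
      have := q.hasFDerivAt.comp_hasDerivWithinAt t (hy t ht)
      simp only [hv, sub_add_cancel]
      exact this
  have hz : ∀ t, v t 0 = 0 := fun t => by
    simp only [hv, add_zero, hq0]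
    exact hXV t _ (hqV _)
  have hwc : ContinuousOn (fun t => q (y t)) (Icc 0 1) := fun t ht => (hw t ht).continuousWithinAt
  rw [← hq0, ← hq0]
  constructor
  · intro h1
    have := ODE_solution_unique_of_mem_Icc_left (v := v) (s := fun _ => univ) (g := fun _ => 0)
      (fun t _ => (hvL t).lipschitzOnWith) hwc
      (fun t ht => (hw t ⟨ht.1.le, ht.2⟩).mono_of_mem_nhdsWithin
        (Icc_mem_nhdsLE_of_mem ht)) (fun _ _ => mem_univ _) continuousOn_const
      (fun t _ => by rw [hz]; exact (hasDerivAt_const t 0).hasDerivWithinAt)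
      (fun _ _ => mem_univ _) h1
    exact this (by simp)
  · intro h0
    have := ODE_solution_unique_of_mem_Icc_right (v := v) (s := fun _ => univ) (g := fun _ => 0)
      (fun t _ => (hvL t).lipschitzOnWith) hwc
      (fun t ht => (hw t ⟨ht.1, ht.2.le⟩).mono_of_mem_nhdsWithin
        (Icc_mem_nhdsGE_of_mem ht)) (fun _ _ => mem_univ _) continuousOn_const
      (fun t _ => by rw [hz]; exact (hasDerivAt_const t 0).hasDerivWithinAt)
      (fun _ _ => mem_univ _) h0
    exact this (by simp)

omit [FiniteDimensional ℝ E] in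
/-- The identity behind Moser's argument: the linearization of the equation
`ω_t(X_t, ·) = -σ`. -/
theorem moserForm_fderiv_apply {β : E → E →L[ℝ] ℝ} {W : Set E} (hW : IsOpen W)
    (hβ : ContDiffOn ℝ ∞ β W) {X : ℝ × E → E} (hX : ContDiff ℝ ∞ X) {t : ℝ} {x : E} (hx : x ∈ W)
    (heq : ∀ᶠ y in 𝓝 x, moserForm β t y (X (t, y)) = -(β y - β 0 - fderiv ℝ β 0 y)) (u w : E) :
    moserForm β t x (fderiv ℝ X (t, x) (0, u)) w = -(fderiv ℝ β x u w - fderiv ℝ β 0 u w) -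
      t * (fderiv ℝ (fderiv ℝ β) x u (X (t, x)) w - fderiv ℝ (fderiv ℝ β) x u w (X (t, x))) := by
  have hβ1 : HasFDerivAt β (fderiv ℝ β x) x :=
    ((hβ.contDiffAt (hW.mem_nhds hx)).differentiableAt (by simp)).hasFDerivAt
  have hβ2 : HasFDerivAt (fderiv ℝ β) (fderiv ℝ (fderiv ℝ β) x) x :=
    (((contDiffOn_fderiv_of_isOpen hW hβ).contDiffAt (hW.mem_nhds hx)).differentiableAt
      (by simp)).hasFDerivAt
  have hd : HasFDerivAt (bilinExtDeriv β)
      ((antisymmetrize E).comp (fderiv ℝ (fderiv ℝ β) x)) x :=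
    (ContinuousLinearMap.hasFDerivAt (E := E →L[ℝ] E →L[ℝ] ℝ) (F := E →L[ℝ] E →L[ℝ] ℝ)
      (antisymmetrize E)).comp x hβ2
  have hA : HasFDerivAt (moserForm β t)
      (t • (antisymmetrize E).comp (fderiv ℝ (fderiv ℝ β) x)) x :=
    ((hd.sub_const _).const_smul t).const_add _
  have hXx : HasFDerivAt (fun y => X (t, y))
      ((fderiv ℝ X (t, x)).comp (ContinuousLinearMap.inr ℝ ℝ E)) x :=
    HasFDerivAt.comp (g := X) (f := fun y => (t, y)) x
      (hX.differentiable (by simp) (t, x)).hasFDerivAt (hasFDerivAt_prodMk_right t x)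
  have h1 := hA.clm_apply hXx
  have h2 := (((hβ1.sub_const (β 0)).sub (fderiv ℝ β 0).hasFDerivAt).neg).congr_of_eventuallyEq heq
  have h3 := DFunLike.congr_fun (DFunLike.congr_fun (h1.unique h2) u) w
  simp at h3
  linarith

-- The explicit dependence on `t` contributes `dβ - dβ₀`, the motion of the base point the second
-- derivative of `β`. This supplies the part of the derivative of `Φ_t^* ω_t` not covered by
-- `moserForm_fderiv_apply`.
omit [FiniteDimensional ℝ E] in
theorem hasDerivWithinAt_moserForm {β : E → E →L[ℝ] ℝ} {W : Set E} (hW : IsOpen W)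
    (hβ : ContDiffOn ℝ ∞ β W) {t : ℝ} {s : Set ℝ} {y : ℝ → E} {y' : E} (hyW : y t ∈ W)
    (hy : HasDerivWithinAt y y' s t) :
    HasDerivWithinAt (fun t => moserForm β t (y t)) ((bilinExtDeriv β (y t) - bilinExtDeriv β 0) +
      t • antisymmetrize E (fderiv ℝ (fderiv ℝ β) (y t) y')) s t := by
  have hβ2 : HasFDerivAt (fderiv ℝ β) (fderiv ℝ (fderiv ℝ β) (y t)) (y t) :=
    (((contDiffOn_fderiv_of_isOpen hW hβ).contDiffAt (hW.mem_nhds hyW)).differentiableAt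
      (by simp)).hasFDerivAt
  have hd : HasDerivWithinAt (fun t => bilinExtDeriv β (y t))
      (antisymmetrize E (fderiv ℝ (fderiv ℝ β) (y t) y')) s t :=
    (ContinuousLinearMap.hasFDerivAt (E := E →L[ℝ] E →L[ℝ] ℝ) (F := E →L[ℝ] E →L[ℝ] ℝ)
      (antisymmetrize E)).comp_hasDerivWithinAt t (hβ2.comp_hasDerivWithinAt t hy)
  have h1 := ((hasDerivWithinAt_id t s).smul (hd.sub_const (bilinExtDeriv β 0))).const_add
    (bilinExtDeriv β 0)
  rw [one_smul, add_comm (id t • _)] at h1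
  exact h1

/-- **Darboux' theorem relative to a Lagrangian subspace**: near the origin, the exterior
derivative of a one-form that vanishes along `V` can be made constant by a change of coordinates
that preserves `V`. -/
theorem exists_constant_bilinExtDeriv {β : E → E →L[ℝ] ℝ} {W : Set E} (hW : IsOpen W)
    (h0 : (0 : E) ∈ W) (hβ : ContDiffOn ℝ ∞ β W)
    (hnd : ∀ v, (∀ w, bilinExtDeriv β 0 v w = 0) → v = 0)
    {V : Submodule ℝ E} (hdim : 2 * Module.finrank ℝ V = Module.finrank ℝ E)
    (hV : ∀ x ∈ W, x ∈ V → ∀ v ∈ V, β x v = 0) :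
    ∃ U : Set E, IsOpen U ∧ 0 ∈ U ∧ ∃ ψ : E → E, ContDiffOn ℝ ∞ ψ U ∧ MapsTo ψ U W ∧ InjOn ψ U ∧
      (∀ x ∈ U, ψ x ∈ V ↔ x ∈ V) ∧ ∀ x ∈ U, ∀ v w,
        bilinExtDeriv β (ψ x) (fderiv ℝ ψ x v) (fderiv ℝ ψ x w) = bilinExtDeriv β 0 v w := by
  obtain ⟨X, hX, hXc, hX0, hX1, hXV, r, hr, hXr⟩ := exists_moser_field hW h0 hβ hnd hdim hV
  obtain ⟨C, hC⟩ := hX.lipschitzWith_of_hasCompactSupport hXc (by simp)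
  obtain ⟨U₀, hU₀, h0U₀, Φ, hΦ, hΦs, hΦc, hΦd⟩ := exists_smooth_flow hX hX0 hX1
  -- Trajectories from `U₁` stay, for all times in `[0, 1]`, where the cutoff does not alter the
  -- Moser equation.
  obtain ⟨U₁, hU₁, hU₁o, h0U₁⟩ := eventually_nhds_iff.1 (hΦs r hr)
  have hsymp : ∀ x ∈ U₀ ∩ U₁, ∀ v w, bilinExtDeriv β (Φ 1 x) (fderiv ℝ (Φ 1) x v)
      (fderiv ℝ (Φ 1) x w) = bilinExtDeriv β 0 v w := by
    rintro x ⟨hx, hx1⟩ v w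
    -- `h t` is `(Φ_t^* ω_t)(v, w)`; it is shown to have zero derivative on `[0, 1]`.
    set h : ℝ → ℝ := fun t =>
      moserForm β t (Φ t x) (fderiv ℝ (Φ t) x v) (fderiv ℝ (Φ t) x w) with hh
    have hd : ∀ t ∈ Icc (0 : ℝ) 1, HasDerivWithinAt h 0 (Icc 0 1) t := by
      intro t ht
      have hlt : ‖Φ t x‖ < r := hU₁ x hx1 t ht
      have hW' : Φ t x ∈ W := (hXr _ hlt).1
      have heq : ∀ᶠ y in 𝓝 (Φ t x),
          moserForm β t y (X (t, y)) = -(β y - β 0 - fderiv ℝ β 0 y) := by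
        filter_upwards [continuous_norm.isOpen_preimage _ isOpen_Iio |>.mem_nhds hlt] with y hy
        exact (hXr y hy).2 t ht
      have hlin := moserForm_fderiv_apply hW hβ hX hW' heq
      have h1 := ((hasDerivWithinAt_moserForm hW hβ hW' ((hΦc x hx).2 t ht)).clm_apply
        ((hΦd x hx v).2 t ht)).clm_apply ((hΦd x hx w).2 t ht)
      refine h1.congr_deriv ?_
      -- Symmetry of the second derivative plays the role of `d(dβ) = 0`: it cancels the terms left
      -- over from the Moser equation.
      have hsym : ∀ a b : E, fderiv ℝ (fderiv ℝ β) (Φ t x) a b =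
          fderiv ℝ (fderiv ℝ β) (Φ t x) b a :=
        (hβ.contDiffAt (hW.mem_nhds hW')).isSymmSndFDerivAt
          (by
            rw [minSmoothness_of_isRCLikeNormedField]
            exact WithTop.coe_le_coe.2 (le_top (a := (2 : ℕ∞))))
      simp only [add_apply, smul_apply, sub_apply, antisymmetrize_apply, bilinExtDeriv_apply,
        smul_eq_mul]
      rw [moserForm_neg_swap β t (Φ t x) _ (fderiv ℝ X (t, Φ t x) (0, fderiv ℝ (Φ t) x w)),
        hlin, hlin, hsym (X (t, Φ t x)) (fderiv ℝ (Φ t) x v),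
        hsym (X (t, Φ t x)) (fderiv ℝ (Φ t) x w),
        hsym (fderiv ℝ (Φ t) x w) (fderiv ℝ (Φ t) x v)]
      ring
    have hconst := constant_of_has_deriv_right_zero (f := h) (a := 0) (b := 1)
      (fun t ht => (hd t ht).continuousWithinAt)
      (fun t ht => (hd t ⟨ht.1, ht.2.le⟩).mono_of_mem_nhdsWithin (Icc_mem_nhdsGE_of_mem ht))
      1 (by simp)
    simp only [hh, moserForm, (hΦd x hx v).1, (hΦd x hx w).1, zero_smul, add_zero, one_smul,
      add_sub_cancel] at hconst
    exact hconst
  -- The derivative of `Φ 1` at the origin pulls a form back to the nondegenerate `dβ₀`, so it is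
  -- injective, and the inverse function theorem applies.
  have hinj : ∃ U₂ ∈ 𝓝 (0 : E), InjOn (Φ 1) U₂ := by
    have hs : HasStrictFDerivAt (Φ 1) (fderiv ℝ (Φ 1) 0) 0 :=
      ((hΦ 1 (by simp)).contDiffAt (hU₀.mem_nhds h0U₀)).hasStrictFDerivAt (by simp)
    have hker : (fderiv ℝ (Φ 1) 0).ker = ⊥ := by
      rw [LinearMap.ker_eq_bot']
      intro v hv
      refine hnd v fun w => ?_
      rw [← hsymp 0 ⟨h0U₀, h0U₁⟩ v w]
      have hv' : fderiv ℝ (Φ 1) 0 v = 0 := hv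
      rw [hv', map_zero, zero_apply]
    let e : E ≃L[ℝ] E := (LinearEquiv.ofInjectiveEndo (fderiv ℝ (Φ 1) 0).toLinearMap
      (LinearMap.ker_eq_bot.1 hker)).toContinuousLinearEquiv
    have he : HasStrictFDerivAt (Φ 1) (e : E →L[ℝ] E) 0 := hs
    exact ⟨_, (he.toOpenPartialHomeomorph (Φ 1)).open_source.mem_nhds
      he.mem_toOpenPartialHomeomorph_source, (he.toOpenPartialHomeomorph (Φ 1)).injOn⟩
  obtain ⟨U₂, hU₂, hinj⟩ := hinj
  refine ⟨U₀ ∩ U₁ ∩ interior U₂, (hU₀.inter hU₁o).inter isOpen_interior,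
    ⟨⟨h0U₀, h0U₁⟩, mem_interior_iff_mem_nhds.2 hU₂⟩, Φ 1,
    (hΦ 1 (by simp)).mono fun x hx => hx.1.1, fun x hx => (hXr _ (hU₁ x hx.1.2 1 (by simp))).1,
    hinj.mono fun x hx => interior_subset hx.2, fun x hx => ?_, fun x hx => hsymp x hx.1⟩
  have := mem_subspace_iff_of_integralCurve hC hXV (hΦc x hx.1.1).2
  rwa [(hΦc x hx.1.1).1] at this

end RelativeDarboux

/-! ### Linear normal form of a Lagrangian subspace -/

section SymplecticBasis

/-- Every symplectic vector space with a Lagrangian subspace is isomorphic to the standard one with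
the real plane. -/
theorem exists_adapted_symplectic_basis {E : Type*} [NormedAddCommGroup E] [NormedSpace ℝ E]
    [FiniteDimensional ℝ E] {A : E →L[ℝ] E →L[ℝ] ℝ} (hanti : ∀ v w, A v w = -A w v)
    (hA : ∀ v, (∀ w, A v w = 0) → v = 0) {n : ℕ} {V : Submodule ℝ E}
    (hVn : Module.finrank ℝ V = n) (hV : ∀ u ∈ V, ∀ v ∈ V, A u v = 0) :
    ∃ T : StdSpace n →L[ℝ] E, Function.Injective T ∧ (∀ v w, A (T v) (T w) = stdForm v w) ∧
      ∀ z, T z ∈ V ↔ z ∈ realPlane n := by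
  let b : Module.Basis (Fin n) ℝ V := Module.finBasisOfFinrankEq ℝ V hVn
  have hb : ∀ i j, A (b i) (b j) = 0 := fun i j => hV _ (b i).2 _ (b j).2
  obtain ⟨e, he⟩ := isInvertible_of_nondegenerate hA
  obtain ⟨V', hV'⟩ := V.exists_isCompl
  -- `c` represents, through `A`, the `j`-th coordinate of `V` extended by zero on a complement; the
  -- sign comes from swapping the arguments of `A`.
  have hc : ∀ j, ∃ c : E, ∀ i, A (b i) c = if i = j then 1 else 0 := by
    intro j
    let ℓ : E →L[ℝ] ℝ := LinearMap.toContinuousLinearMap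
      ((b.coord j).comp (V.projectionOnto V' hV'))
    refine ⟨-e.symm ℓ, fun i => ?_⟩
    have h1 : A (e.symm ℓ) = ℓ := by rw [← he]; simp
    rw [map_neg, hanti, neg_neg, h1]
    simp [ℓ, Finsupp.single_apply]
  choose c hc using hc
  -- A correction in `V` makes the `c i` mutually orthogonal. The pairings with `b` do not change
  -- because `V` is isotropic, and the factor 1/2 occurs because `f i` and `f j` each remove half of
  -- `A (c i) (c j)`.
  let f : Fin n → E := fun i => c i - ∑ k, (A (c i) (c k) / 2) • (b k : E)
  have hbf : ∀ i j, A (b i) (f j) = if i = j then 1 else 0 := fun i j => by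
    simp [f, hb, hc]
  have hfb : ∀ i j, A (f j) (b i) = -if i = j then 1 else 0 := fun i j => by rw [hanti, hbf]
  have hff : ∀ i j, A (f i) (f j) = 0 := fun i j => by
    have : A (f i) (f j) = A (f i) (c j) - ∑ k, (A (c j) (c k) / 2) * A (f i) (b k) := by
      change A (f i) (c j - ∑ k, (A (c j) (c k) / 2) • (b k : E)) = _
      simp only [map_sub, map_sum, map_smul, smul_eq_mul]
    rw [this]
    have h2 : A (f i) (c j) = A (c i) (c j) - ∑ k, (A (c i) (c k) / 2) * A (b k) (c j) := by
      simp [f]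
    rw [h2]
    simp only [hc, hfb]
    simp
    linarith [hanti (c i) (c j)]
  let T : StdSpace n →L[ℝ] E := ∑ i, ((EuclideanSpace.proj (Sum.inl i) :
      StdSpace n →L[ℝ] ℝ).smulRight (b i : E) +
    (EuclideanSpace.proj (Sum.inr i) : StdSpace n →L[ℝ] ℝ).smulRight (f i))
  have hT : ∀ z, T z = ∑ i, (z (Sum.inl i) • (b i : E) + z (Sum.inr i) • f i) := fun z => by
    simp [T]
  -- Pairing with the basis recovers the coordinates: this gives injectivity, the standard form, and
  -- vanishing of the `y`-coordinates of `z` when `T z ∈ V`.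
  have hbT : ∀ j z, A (b j) (T z) = z (Sum.inr j) := fun j z => by
    simp [hT, hb, hbf]
  have hfT : ∀ j z, A (f j) (T z) = -z (Sum.inl j) := fun j z => by
    simp [hT, hfb, hff]
  refine ⟨T, ?_, ?_, ?_⟩
  · rw [injective_iff_map_eq_zero]
    intro z hz
    ext (i | i)
    · have := hfT i z
      rw [hz, map_zero] at this
      simpa using this.symm
    · have := hbT i z
      rw [hz, map_zero] at this
      simpa using this.symm
  · intro v w
    have : A (T v) (T w) =
        ∑ i, (v (Sum.inl i) * A (b i) (T w) + v (Sum.inr i) * A (f i) (T w)) := by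
      rw [hT v]
      simp
    rw [this, stdForm]
    simp only [hbT, hfT]
    exact Finset.sum_congr rfl fun i _ => by ring
  · intro z
    constructor
    · intro hz i
      rw [← hbT]
      exact hV _ (b i).2 _ hz
    · intro hz
      rw [hT]
      refine V.sum_mem fun i _ => ?_
      rw [hz i, zero_smul, add_zero]
      exact V.smul_mem _ (b i).2

end SymplecticBasis

/-! ### Darboux balls in a normed space relative to a subspace -/

section LocalRelativeBall

/-- A relative Darboux ball for a Lagrangian subspace along which a primitive of the symplectic form
vanishes. -/
theorem exists_relative_darboux_ball {E : Type*} [NormedAddCommGroup E] [NormedSpace ℝ E]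
    [FiniteDimensional ℝ E] {β : E → E →L[ℝ] ℝ} {W : Set E} (hW : IsOpen W) {x₀ : E}
    (hx₀ : x₀ ∈ W) (hβ : ContDiffOn ℝ ∞ β W)
    (hnd : ∀ v, (∀ w, bilinExtDeriv β x₀ v w = 0) → v = 0) {n : ℕ} {V : Submodule ℝ E}
    (hx₀V : x₀ ∈ V) (hVn : Module.finrank ℝ V = n)
    (hdim : 2 * Module.finrank ℝ V = Module.finrank ℝ E)
    (hV : ∀ x ∈ W, x ∈ V → ∀ v ∈ V, β x v = 0) :
    ∃ O : Set (StdSpace n), IsOpen O ∧ 0 ∈ O ∧ ∃ ψ : StdSpace n → E,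
      ContDiffOn ℝ ∞ ψ O ∧ MapsTo ψ O W ∧ InjOn ψ O ∧ (∀ z ∈ O, ψ z ∈ V ↔ z ∈ realPlane n) ∧
      ∀ z ∈ O, ∀ v w, bilinExtDeriv β (ψ z) (fderiv ℝ ψ z v) (fderiv ℝ ψ z w) = stdForm v w := by
  set W' : Set E := (fun y => x₀ + y) ⁻¹' W with hW'def
  have hW' : IsOpen W' := hW.preimage (continuous_const.add continuous_id)
  have h0 : (0 : E) ∈ W' := by simpa [hW'def] using hx₀
  set β' : E → E →L[ℝ] ℝ := fun y => β (x₀ + y) with hβ'def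
  have hd : ∀ y, bilinExtDeriv β' y = bilinExtDeriv β (x₀ + y) := fun y => by
    simp only [bilinExtDeriv, hβ'def, fderiv_comp_add_left]
  have hβ' : ContDiffOn ℝ ∞ β' W' := hβ.comp (contDiff_const.add contDiff_id).contDiffOn
    fun y hy => hy
  have hnd' : ∀ v, (∀ w, bilinExtDeriv β' 0 v w = 0) → v = 0 := by
    rw [hd, add_zero]
    exact hnd
  have hV' : ∀ x ∈ W', x ∈ V → ∀ v ∈ V, β' x v = 0 := fun x hx hxV v hv =>
    hV _ hx (V.add_mem hx₀V hxV) v hv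
  obtain ⟨U, hU, h0U, φ, hφ, hφW, hφi, hφV, hφs⟩ :=
    exists_constant_bilinExtDeriv hW' h0 hβ' hnd' hdim hV'
  obtain ⟨T, hTi, hTs, hTV⟩ := exists_adapted_symplectic_basis (A := bilinExtDeriv β' 0)
    (fun v w => by simp only [bilinExtDeriv_apply]; ring) hnd' hVn
    (fun u hu v hv => by
      simpa using moserForm_eq_zero_of_subspace hW' h0 hβ' hV' 0 h0 V.zero_mem hu hv)
  refine ⟨T ⁻¹' U, hU.preimage T.continuous, by simpa using h0U, fun z => x₀ + φ (T z),
    contDiffOn_const.add (hφ.comp T.contDiff.contDiffOn fun z hz => hz), fun z hz => hφW hz,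
    fun z hz z' hz' h => hTi (hφi hz hz' (add_left_cancel h)), fun z hz => ?_,
    fun z hz v w => ?_⟩
  · rw [V.add_mem_iff_right hx₀V, hφV _ hz, hTV]
  · have h1 : HasFDerivAt φ (fderiv ℝ φ (T z)) (T z) :=
      ((hφ.contDiffAt (hU.mem_nhds hz)).differentiableAt (by simp)).hasFDerivAt
    have h2 : HasFDerivAt (fun z => x₀ + φ (T z)) ((fderiv ℝ φ (T z)).comp T) z :=
      (h1.comp z T.hasFDerivAt).const_add x₀
    rw [h2.fderiv, ← hd, ← hTs]
    exact hφs _ hz _ _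

end LocalRelativeBall

/-! ### Pulling back one-forms to normed spaces -/

section Pullback

theorem extDeriv_ofSubsingleton_apply {E : Type*} [NormedAddCommGroup E] [NormedSpace ℝ E]
    {β : E → E →L[ℝ] ℝ} {x : E} (hβ : DifferentiableAt ℝ β x) (v w : E) :
    extDeriv (fun y : E => ContinuousAlternatingMap.ofSubsingleton ℝ E ℝ (0 : Fin 1) (β y)) x
      ![v, w] = bilinExtDeriv β x v w := by
  have h1 : DifferentiableAt ℝ
      (fun y : E => ContinuousAlternatingMap.ofSubsingleton ℝ E ℝ (0 : Fin 1) (β y)) x :=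
    (ContinuousAlternatingMap.ofSubsingletonLIE (𝕜 := ℝ) (E := E) (F := ℝ)
      (0 : Fin 1)).differentiable.differentiableAt.comp x hβ
  have h2 : ∀ a b : E, fderiv ℝ (fun y => β y a) x b = fderiv ℝ β x b a := fun a b => by
    rw [fderiv_clm_apply hβ (differentiableAt_const a)]
    simp
  rw [extDeriv_apply h1, Fin.sum_univ_two]
  simp [bilinExtDeriv_apply, Fin.removeNth, h2]
  ring

/-- The product rule produces a term with the second derivative of `g`, which is symmetric and drops
out on antisymmetrizing. -/
theorem bilinExtDeriv_pullback {E E' : Type*} [NormedAddCommGroup E] [NormedSpace ℝ E]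
    [NormedAddCommGroup E'] [NormedSpace ℝ E'] {β : E → E →L[ℝ] ℝ} {g : E' → E} {y : E'}
    (hβ : DifferentiableAt ℝ β (g y)) (hg : ContDiffAt ℝ ∞ g y) (v w : E') :
    bilinExtDeriv (fun y => (β (g y)).comp (fderiv ℝ g y)) y v w =
      bilinExtDeriv β (g y) (fderiv ℝ g y v) (fderiv ℝ g y w) := by
  have hg1 : HasFDerivAt g (fderiv ℝ g y) y := (hg.differentiableAt (by simp)).hasFDerivAt
  have hg2 : HasFDerivAt (fderiv ℝ g) (fderiv ℝ (fderiv ℝ g) y) y :=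
    ((hg.fderiv_right (m := ∞) (by simp)).differentiableAt (by simp)).hasFDerivAt
  have h1 := (hβ.hasFDerivAt.comp y hg1).clm_comp hg2
  have h2 : HasFDerivAt (fun y => (β (g y)).comp (fderiv ℝ g y)) _ y := h1
  have hsym : ∀ a b, fderiv ℝ (fderiv ℝ g) y a b = fderiv ℝ (fderiv ℝ g) y b a :=
    hg.isSymmSndFDerivAt (by
      rw [minSmoothness_of_isRCLikeNormedField]
      exact WithTop.coe_le_coe.2 (le_top (a := (2 : ℕ∞))))
  rw [bilinExtDeriv_apply, h2.fderiv]
  simp [bilinExtDeriv_apply, hsym v w]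

variable {E : Type*} [NormedAddCommGroup E] [NormedSpace ℝ E] {H : Type*} [TopologicalSpace H]
  {I : ModelWithCorners ℝ E H} {M : Type*} [TopologicalSpace M] [ChartedSpace H M]
  {E' : Type*} [NormedAddCommGroup E'] [NormedSpace ℝ E']
  {E'' : Type*} [NormedAddCommGroup E''] [NormedSpace ℝ E'']

/-- The pullback of a one-form on `M` under a map from a normed space to `M`. -/
def OneForm.pullback (β : OneForm I M) (F : E' → M) (y : E') : E' →L[ℝ] ℝ :=
  (β (F y)).comp (mfderiv 𝓘(ℝ, E') I F y)

theorem OneForm.pullback_extChartAt_symm (β : OneForm I M) (x : M) :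
    β.pullback (extChartAt I x).symm = β.localExpr x := rfl

theorem OneForm.pullback_congr (β : OneForm I M) {F G : E' → M} {y : E'} (h : F =ᶠ[𝓝 y] G) :
    β.pullback F y = β.pullback G y := by
  -- The type of `β x` depends on `x`; regarding all tangent spaces as `E` makes the base point
  -- replaceable.
  have key : ∀ (x x' : M) (_ : x = x') (A : E' →L[ℝ] E),
      ContinuousLinearMap.comp (β x : E →L[ℝ] ℝ) A =
        ContinuousLinearMap.comp (β x' : E →L[ℝ] ℝ) A := by
    rintro x _ rfl A
    rfl
  have h1 := key _ _ h.eq_of_nhds (mfderiv 𝓘(ℝ, E') I G y)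
  unfold OneForm.pullback
  rw [h.mfderiv_eq]
  exact h1

theorem OneForm.pullback_comp (β : OneForm I M) {F : E' → M} {g : E'' → E'} {y : E''}
    (hF : MDifferentiableAt 𝓘(ℝ, E') I F (g y)) (hg : DifferentiableAt ℝ g y) :
    β.pullback (F ∘ g) y = (β.pullback F (g y)).comp (fderiv ℝ g y) := by
  unfold OneForm.pullback
  rw [mfderiv_comp y hF hg.mdifferentiableAt, mfderiv_eq_fderiv]
  rfl

variable [I.Boundaryless] [IsManifold I ∞ M]

omit [IsManifold I ∞ M] in
theorem OneForm.IsSmooth.contDiffAt_localExpr {β : OneForm I M} (hβ : β.IsSmooth) (x : M) {y : E}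
    (hy : y ∈ (extChartAt I x).target) : ContDiffAt ℝ ∞ (β.localExpr x) y :=
  (hβ x).contDiffAt ((isOpen_extChartAt_target x).mem_nhds hy)

omit [I.Boundaryless] in
theorem contDiffAt_extChartAt_comp {F : E' → M} {y : E'}
    (hF : ContMDiffAt 𝓘(ℝ, E') I ∞ F y) {x : M} (hx : F y ∈ (extChartAt I x).source) :
    ContDiffAt ℝ ∞ (extChartAt I x ∘ F) y := by
  rw [← contMDiffAt_iff_contDiffAt]
  exact (contMDiffAt_extChartAt' (by rwa [extChartAt_source] at hx)).comp y hF

/-- Near `y` the map `F` factors through the chart, which reduces smoothness and naturality on `M`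
to calculus in normed spaces. -/
theorem OneForm.pullback_eventuallyEq (β : OneForm I M) {F : E' → M} {O : Set E'} (hO : IsOpen O)
    (hF : ContMDiffOn 𝓘(ℝ, E') I ∞ F O) {y : E'} (hy : y ∈ O) {x : M}
    (hx : F y ∈ (extChartAt I x).source) :
    β.pullback F =ᶠ[𝓝 y] fun y' => (β.localExpr x (extChartAt I x (F y'))).comp
      (fderiv ℝ (extChartAt I x ∘ F) y') := by
  have hFc : ∀ y' ∈ O, ContMDiffAt 𝓘(ℝ, E') I ∞ F y' := fun y' hy' =>
    hF.contMDiffAt (hO.mem_nhds hy')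
  have hs := (hFc y hy).continuousAt.eventually_mem ((isOpen_extChartAt_source x).mem_nhds hx)
  filter_upwards [hs.eventually_nhds, hO.mem_nhds hy] with y' hy' hy'O
  have h1 : F =ᶠ[𝓝 y'] (extChartAt I x).symm ∘ (extChartAt I x ∘ F) := by
    filter_upwards [hy'] with z hz
    exact ((extChartAt I x).left_inv hz).symm
  have hmem : (extChartAt I x ∘ F) y' ∈ (extChartAt I x).target :=
    (extChartAt I x).map_source hy'.self_of_nhds
  rw [β.pullback_congr h1, OneForm.pullback_comp β
    ((contMDiffOn_extChartAt_symm (n := ∞) x).contMDiffAt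
      ((isOpen_extChartAt_target x).mem_nhds hmem) |>.mdifferentiableAt (by simp))
    ((contDiffAt_extChartAt_comp (hFc y' hy'O) hy'.self_of_nhds).differentiableAt (by simp))]
  rfl

theorem OneForm.IsSmooth.contDiffOn_pullback {β : OneForm I M} (hβ : β.IsSmooth) {F : E' → M}
    {O : Set E'} (hO : IsOpen O) (hF : ContMDiffOn 𝓘(ℝ, E') I ∞ F O) :
    ContDiffOn ℝ ∞ (β.pullback F) O := by
  intro y hy
  have hx : F y ∈ (extChartAt I (F y)).source := mem_extChartAt_source (F y)
  have hg := contDiffAt_extChartAt_comp (hF.contMDiffAt (hO.mem_nhds hy)) hx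
  have h1 : ContDiffAt ℝ ∞ (β.localExpr (F y)) ((extChartAt I (F y) ∘ F) y) :=
    hβ.contDiffAt_localExpr (F y) ((extChartAt I (F y)).map_source hx)
  exact (((h1.comp y hg).clm_comp (hg.fderiv_right (m := ∞) (by simp))).congr_of_eventuallyEq
    (β.pullback_eventuallyEq hO hF hy hx)).contDiffWithinAt

omit [IsManifold I ∞ M] in
theorem OneForm.IsSmooth.d_eq {β : OneForm I M} (hβ : β.IsSmooth) (x : M)
    (v w : TangentSpace I x) :
    β.d x v w = bilinExtDeriv (β.localExpr x) (extChartAt I x x)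
      (mfderiv I 𝓘(ℝ, E) (extChartAt I x) x v) (mfderiv I 𝓘(ℝ, E) (extChartAt I x) x w) :=
  extDeriv_ofSubsingleton_apply ((hβ.contDiffAt_localExpr x
    (mem_extChartAt_target x)).differentiableAt (by simp)) _ _

/-- The preferred chart at `x` has the identity as its derivative at `x`, under the identification
of the tangent space with `E`. -/
theorem OneForm.IsSmooth.d_eq_localExpr {β : OneForm I M} (hβ : β.IsSmooth) (x : M)
    (v w : TangentSpace I x) :
    β.d x v w = bilinExtDeriv (β.localExpr x) (extChartAt I x x) v w := by
  have := IsManifold.of_le (I := I) (M := M) (m := 1) (n := ∞) (by simp)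
  rw [hβ.d_eq, mfderiv_extChartAt_self]
  rfl

/-- Naturality of the exterior derivative. -/
theorem OneForm.IsSmooth.d_mfderiv {β : OneForm I M} (hβ : β.IsSmooth) {F : E' → M}
    {O : Set E'} (hO : IsOpen O) (hF : ContMDiffOn 𝓘(ℝ, E') I ∞ F O) {y : E'} (hy : y ∈ O)
    (v w : E') :
    β.d (F y) (mfderiv 𝓘(ℝ, E') I F y v) (mfderiv 𝓘(ℝ, E') I F y w) =
      bilinExtDeriv (β.pullback F) y v w := by
  have hFy := hF.contMDiffAt (hO.mem_nhds hy)
  have hx : F y ∈ (extChartAt I (F y)).source := mem_extChartAt_source (F y)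
  have hg := contDiffAt_extChartAt_comp hFy hx
  have h1 : DifferentiableAt ℝ (β.localExpr (F y)) ((extChartAt I (F y) ∘ F) y) :=
    (hβ.contDiffAt_localExpr (F y) ((extChartAt I (F y)).map_source hx)).differentiableAt (by simp)
  have h2 : bilinExtDeriv (β.pullback F) y v w = bilinExtDeriv (fun y' =>
      (β.localExpr (F y) ((extChartAt I (F y) ∘ F) y')).comp
        (fderiv ℝ (extChartAt I (F y) ∘ F) y')) y v w := by
    unfold bilinExtDeriv
    rw [(β.pullback_eventuallyEq hO hF hy hx).fderiv_eq]
    rfl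
  have hc : ∀ u, fderiv ℝ (extChartAt I (F y) ∘ F) y u =
      mfderiv I 𝓘(ℝ, E) (extChartAt I (F y)) (F y) (mfderiv 𝓘(ℝ, E') I F y u) := fun u => by
    have h3 : MDifferentiableAt I 𝓘(ℝ, E) (extChartAt I (F y)) (F y) :=
      (contMDiffAt_extChartAt (n := ∞)).mdifferentiableAt (by simp)
    rw [← mfderiv_eq_fderiv, mfderiv_comp y h3 (hFy.mdifferentiableAt (by simp))]
    rfl
  rw [h2, bilinExtDeriv_pullback h1 hg, hβ.d_eq, hc, hc]
  rfl

end Pullback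

/-! ### The symplectic form of the symplectization -/

section SymplectizationForm

variable {m : ℕ} {P : Type*} [TopologicalSpace P] [ChartedSpace (EuclideanSpace ℝ (Fin (2 * m))) P]

/-- The model vector space of the symplectization. -/
abbrev SympSpace (m : ℕ) := ℝ × (EuclideanSpace ℝ (Fin (2 * m)) × ℝ)

theorem contactForm_apply (lam : OneForm (𝓡 (2 * m)) P) (y : P × ℝ)
    (v : EuclideanSpace ℝ (Fin (2 * m)) × ℝ) :
    (contactForm lam y : (EuclideanSpace ℝ (Fin (2 * m)) × ℝ) →L[ℝ] ℝ) v =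
      v.2 - (lam y.1 : EuclideanSpace ℝ (Fin (2 * m)) →L[ℝ] ℝ) v.1 := by
  have h1 : mfderiv (contModel m) 𝓘(ℝ, ℝ) (Prod.snd : P × ℝ → ℝ) y = _ := mfderiv_snd
  have h2 : mfderiv (contModel m) (𝓡 (2 * m)) (Prod.fst : P × ℝ → P) y = _ := mfderiv_fst
  unfold contactForm dzForm
  rw [h1, h2]
  rfl

theorem expContactForm_apply (lam : OneForm (𝓡 (2 * m)) P) (x : ℝ × (P × ℝ)) (v : SympSpace m) :
    (expContactForm lam x : SympSpace m →L[ℝ] ℝ) v =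
      Real.exp x.1 * (v.2.2 - (lam x.2.1 : EuclideanSpace ℝ (Fin (2 * m)) →L[ℝ] ℝ) v.2.1) := by
  have h1 : mfderiv (sympModel m) (contModel m) (Prod.snd : ℝ × (P × ℝ) → P × ℝ) x = _ :=
    mfderiv_snd
  rw [← contactForm_apply lam x.2 v.2]
  unfold expContactForm
  rw [h1]
  rfl

theorem expContactForm_apply_eq_contactForm (lam : OneForm (𝓡 (2 * m)) P) (x : ℝ × (P × ℝ))
    (v : SympSpace m) : (expContactForm lam x : SympSpace m →L[ℝ] ℝ) v =
      Real.exp x.1 * (contactForm lam x.2 : (EuclideanSpace ℝ (Fin (2 * m)) × ℝ) →L[ℝ] ℝ) v.2 := by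
  rw [expContactForm_apply, contactForm_apply]

variable {E' : Type*} [NormedAddCommGroup E'] [NormedSpace ℝ E']

theorem mfderiv_symp_snd_fst {F : E' → ℝ × (P × ℝ)} {y : E'}
    (hF : MDifferentiableAt 𝓘(ℝ, E') (sympModel m) F y) (v : E') :
    (mfderiv 𝓘(ℝ, E') (sympModel m) F y v : SympSpace m).2.1 =
      mfderiv 𝓘(ℝ, E') (𝓡 (2 * m)) (fun y => (F y).2.1) y v := by
  have h1 := hF.hasMFDerivAt
  have h2 := ((hasMFDerivAt_fst (I := 𝓡 (2 * m)) (I' := 𝓘(ℝ, ℝ)) (F y).2).comp y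
    ((hasMFDerivAt_snd (I := 𝓘(ℝ, ℝ)) (I' := contModel m) (F y)).comp y h1))
  have h3 : HasMFDerivAt 𝓘(ℝ, E') (𝓡 (2 * m)) (fun y => (F y).2.1) y _ := h2
  rw [h3.mfderiv]
  rfl

theorem mfderiv_symp_snd_snd {F : E' → ℝ × (P × ℝ)} {y : E'}
    (hF : MDifferentiableAt 𝓘(ℝ, E') (sympModel m) F y) (v : E') :
    (mfderiv 𝓘(ℝ, E') (sympModel m) F y v : SympSpace m).2.2 =
      fderiv ℝ (fun y => (F y).2.2) y v := by
  have h1 := hF.hasMFDerivAt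
  have h2 := ((hasMFDerivAt_snd (I := 𝓡 (2 * m)) (I' := 𝓘(ℝ, ℝ)) (F y).2).comp y
    ((hasMFDerivAt_snd (I := 𝓘(ℝ, ℝ)) (I' := contModel m) (F y)).comp y h1))
  have h3 : HasMFDerivAt 𝓘(ℝ, E') 𝓘(ℝ, ℝ) (fun y => (F y).2.2) y _ := h2
  rw [← mfderiv_eq_fderiv, h3.mfderiv]
  rfl

/-- In components the `s`-coordinate enters only through the factor `e^s`, so adding `σ` to it
multiplies the pullback by `e^σ`. -/
theorem pullback_expContactForm (lam : OneForm (𝓡 (2 * m)) P) {F : E' → ℝ × (P × ℝ)} {y : E'}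
    (hF : MDifferentiableAt 𝓘(ℝ, E') (sympModel m) F y) :
    (expContactForm lam).pullback F y = Real.exp (F y).1 •
      (fderiv ℝ (fun y => (F y).2.2) y - lam.pullback (fun y => (F y).2.1) y) := by
  ext v
  refine (expContactForm_apply lam (F y) (mfderiv 𝓘(ℝ, E') (sympModel m) F y v)).trans ?_
  rw [mfderiv_symp_snd_fst hF, mfderiv_symp_snd_snd hF]
  rfl

variable [IsManifold (𝓡 (2 * m)) ∞ P]

theorem expContactForm_localExpr (lam : OneForm (𝓡 (2 * m)) P) (x : ℝ × (P × ℝ))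
    {y : SympSpace m} (hy : y ∈ (extChartAt (sympModel m) x).target) :
    (expContactForm lam).localExpr x y = Real.exp y.1 •
      ((ContinuousLinearMap.snd ℝ (EuclideanSpace ℝ (Fin (2 * m))) ℝ).comp
          (ContinuousLinearMap.snd ℝ ℝ _) -
        (lam.localExpr x.2.1 y.2.1).comp
          ((ContinuousLinearMap.fst ℝ (EuclideanSpace ℝ (Fin (2 * m))) ℝ).comp
            (ContinuousLinearMap.snd ℝ ℝ _))) := by
  have hF : MDifferentiableAt 𝓘(ℝ, SympSpace m) (sympModel m)
      (extChartAt (sympModel m) x).symm y :=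
    ((contMDiffOn_extChartAt_symm (n := ∞) x).contMDiffAt
      ((isOpen_extChartAt_target x).mem_nhds hy)).mdifferentiableAt (by simp)
  have hy' : y.2.1 ∈ (extChartAt (𝓡 (2 * m)) x.2.1).target := by
    rw [extChartAt_prod, extChartAt_prod] at hy
    exact hy.2.1
  have hP : MDifferentiableAt (𝓡 (2 * m)) (𝓡 (2 * m))
      (extChartAt (𝓡 (2 * m)) x.2.1).symm y.2.1 :=
    ((contMDiffOn_extChartAt_symm (n := ∞) x.2.1).contMDiffAt
      ((isOpen_extChartAt_target x.2.1).mem_nhds hy')).mdifferentiableAt (by simp)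
  have h1 : ∀ y : SympSpace m, (extChartAt (sympModel m) x).symm y =
      (y.1, ((extChartAt (𝓡 (2 * m)) x.2.1).symm y.2.1, y.2.2)) := fun y => by
    simp only [extChartAt_prod]
    rfl
  have h2 : fderiv ℝ (fun y : SympSpace m => y.2.2) y =
      (ContinuousLinearMap.snd ℝ (EuclideanSpace ℝ (Fin (2 * m))) ℝ).comp
          (ContinuousLinearMap.snd ℝ ℝ _) :=
    ContinuousLinearMap.fderiv ((ContinuousLinearMap.snd ℝ (EuclideanSpace ℝ (Fin (2 * m))) ℝ).comp
          (ContinuousLinearMap.snd ℝ ℝ _))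
  have h3 : fderiv ℝ (fun y : SympSpace m => y.2.1) y =
      (ContinuousLinearMap.fst ℝ (EuclideanSpace ℝ (Fin (2 * m))) ℝ).comp
          (ContinuousLinearMap.snd ℝ ℝ _) :=
    ContinuousLinearMap.fderiv ((ContinuousLinearMap.fst ℝ (EuclideanSpace ℝ (Fin (2 * m))) ℝ).comp
          (ContinuousLinearMap.snd ℝ ℝ _))
  have h4 : lam.pullback (fun y : SympSpace m => (extChartAt (𝓡 (2 * m)) x.2.1).symm y.2.1) y =
      (lam.localExpr x.2.1 y.2.1).comp
          ((ContinuousLinearMap.fst ℝ (EuclideanSpace ℝ (Fin (2 * m))) ℝ).comp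
            (ContinuousLinearMap.snd ℝ ℝ _)) := by
    rw [← h3]
    exact lam.pullback_comp (F := (extChartAt (𝓡 (2 * m)) x.2.1).symm)
      (g := fun y : SympSpace m => y.2.1) hP (by fun_prop)
  rw [← OneForm.pullback_extChartAt_symm, pullback_expContactForm lam hF]
  simp only [h1]
  rw [h2, h4]

theorem isSmooth_expContactForm {lam : OneForm (𝓡 (2 * m)) P} (hlam : lam.IsSmooth) :
    (expContactForm lam).IsSmooth := by
  intro x
  refine ContDiffOn.congr ?_ fun y hy => expContactForm_localExpr lam x hy
  have h1 : ContDiffOn ℝ ∞ (fun y : SympSpace m => lam.localExpr x.2.1 y.2.1)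
      (extChartAt (sympModel m) x).target := by
    refine (hlam x.2.1).comp (by fun_prop) fun y hy => ?_
    rw [extChartAt_prod, extChartAt_prod] at hy
    exact hy.2.1
  exact (Real.contDiff_exp.comp contDiff_fst).contDiffOn.smul
    (contDiffOn_const.sub (h1.clm_comp contDiffOn_const))

/-- The symplectic form of the symplectization, in coordinates. -/
theorem sympForm_apply {lam : OneForm (𝓡 (2 * m)) P} (hlam : lam.IsSmooth) (x : ℝ × (P × ℝ))
    (v w : SympSpace m) :
    sympForm lam x v w = Real.exp x.1 *
      (v.1 * (w.2.2 - lam.localExpr x.2.1 (extChartAt (𝓡 (2 * m)) x.2.1 x.2.1) w.2.1) -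
        w.1 * (v.2.2 - lam.localExpr x.2.1 (extChartAt (𝓡 (2 * m)) x.2.1 x.2.1) v.2.1) -
        bilinExtDeriv (lam.localExpr x.2.1) (extChartAt (𝓡 (2 * m)) x.2.1 x.2.1) v.2.1 w.2.1) := by
  set y : SympSpace m := extChartAt (sympModel m) x x with hy
  have hyt : y ∈ (extChartAt (sympModel m) x).target := mem_extChartAt_target x
  have hy1 : y.1 = x.1 := by rw [hy, extChartAt_prod]; rfl
  have hy2 : y.2.1 = extChartAt (𝓡 (2 * m)) x.2.1 x.2.1 := by
    rw [hy, extChartAt_prod, extChartAt_prod]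
    rfl
  have hl : HasFDerivAt (lam.localExpr x.2.1) (fderiv ℝ (lam.localExpr x.2.1) y.2.1) y.2.1 := by
    rw [hy2]
    exact ((hlam.contDiffAt_localExpr x.2.1 (mem_extChartAt_target x.2.1)).differentiableAt
      (by simp)).hasFDerivAt
  have h1 : HasFDerivAt (fun y : SympSpace m => Real.exp y.1)
      (Real.exp y.1 • ContinuousLinearMap.fst ℝ ℝ (EuclideanSpace ℝ (Fin (2 * m)) × ℝ)) y :=
    hasFDerivAt_fst.exp
  have h2 : HasFDerivAt (fun y : SympSpace m => lam.localExpr x.2.1 y.2.1)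
      ((fderiv ℝ (lam.localExpr x.2.1) y.2.1).comp
        ((ContinuousLinearMap.fst ℝ (EuclideanSpace ℝ (Fin (2 * m))) ℝ).comp
          (ContinuousLinearMap.snd ℝ ℝ _))) y :=
    HasFDerivAt.comp (g := lam.localExpr x.2.1) (f := fun y : SympSpace m => y.2.1) y hl
      ((ContinuousLinearMap.fst ℝ (EuclideanSpace ℝ (Fin (2 * m))) ℝ).comp
          (ContinuousLinearMap.snd ℝ ℝ _)).hasFDerivAt
  have h3 := h1.smul ((h2.clm_comp (hasFDerivAt_const
    ((ContinuousLinearMap.fst ℝ (EuclideanSpace ℝ (Fin (2 * m))) ℝ).comp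
      (ContinuousLinearMap.snd ℝ ℝ _)) y)).const_sub
    ((ContinuousLinearMap.snd ℝ (EuclideanSpace ℝ (Fin (2 * m))) ℝ).comp
      (ContinuousLinearMap.snd ℝ ℝ _)))
  have h4 := (h3.congr_of_eventuallyEq (f₁ := (expContactForm lam).localExpr x) (by
    filter_upwards [(isOpen_extChartAt_target x).mem_nhds hyt] with z hz using
      expContactForm_localExpr lam x hz)).fderiv
  refine ((isSmooth_expContactForm hlam).d_eq_localExpr x v w).trans ?_
  rw [← hy2, ← hy1, bilinExtDeriv_apply, bilinExtDeriv_apply, ← hy, h4]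
  simp
  ring

/-- Here `ω = e^s (ds ∧ α - dλ)`. Testing against `∂_z` kills the `s`-component of `v`, vectors from
`P` kill its `P`-component by nondegeneracy of `dλ`, and `∂_s` kills the rest. -/
theorem sympForm_nondegenerate {lam : OneForm (𝓡 (2 * m)) P} (hlam : IsLiouvilleForm lam)
    (x : ℝ × (P × ℝ)) (v : SympSpace m) (hv : ∀ w : SympSpace m, sympForm lam x v w = 0) :
    v = 0 := by
  set ℓ := lam.localExpr x.2.1 (extChartAt (𝓡 (2 * m)) x.2.1 x.2.1) with hℓ
  set B := bilinExtDeriv (lam.localExpr x.2.1) (extChartAt (𝓡 (2 * m)) x.2.1 x.2.1) with hB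
  have hv' : ∀ w : SympSpace m, v.1 * (w.2.2 - ℓ w.2.1) - w.1 * (v.2.2 - ℓ v.2.1) -
      B v.2.1 w.2.1 = 0 := fun w => by
    have := hv w
    rw [sympForm_apply hlam.smooth] at this
    exact (mul_eq_zero.1 this).resolve_left (Real.exp_ne_zero _)
  have h1 : v.1 = 0 := by simpa using hv' (0, 0, 1)
  have h2 : v.2.1 = 0 := by
    refine hlam.nondegenerate x.2.1 v.2.1 fun w => ?_
    refine (hlam.smooth.d_eq_localExpr _ _ _).trans ?_
    have h := hv' (0, w, 0)
    simp only [h1, zero_mul, sub_zero, zero_sub, neg_eq_zero] at h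
    exact h
  have h3 : v.2.2 = 0 := by simpa [h1, h2] using hv' (1, 0, 0)
  exact Prod.ext h1 (Prod.ext h2 h3)

end SymplectizationForm

/-! ### Relative Darboux balls in the positive end and their translates -/

section CylindricalEnd

variable {m : ℕ} {P : Type*} [TopologicalSpace P] [ChartedSpace (EuclideanSpace ℝ (Fin (2 * m))) P]
  [IsManifold (𝓡 (2 * m)) ∞ P]

/-- The derivative of the inverse of an extended chart is bijective. -/
theorem bijective_mfderiv_extend_symm {E : Type*} [NormedAddCommGroup E] [NormedSpace ℝ E]
    [FiniteDimensional ℝ E] {H : Type*} [TopologicalSpace H] {I : ModelWithCorners ℝ E H}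
    [I.Boundaryless] {M : Type*} [TopologicalSpace M] [ChartedSpace H M] [IsManifold I ∞ M]
    {φ : OpenPartialHomeomorph M H} (hφ : φ ∈ IsManifold.maximalAtlas I ∞ M) {y : E}
    (hy : y ∈ (φ.extend I).target) :
    Function.Bijective (mfderiv 𝓘(ℝ, E) I (φ.extend I).symm y : E → E) := by
  have ht : IsOpen (φ.extend I).target := φ.isOpen_extend_target
  have hx : (φ.extend I).symm y ∈ φ.source := by
    rw [← φ.extend_source (I := I)]
    exact (φ.extend I).map_target hy
  have h1 : MDifferentiableAt 𝓘(ℝ, E) I (φ.extend I).symm y :=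
    ((contMDiffOn_extend_symm hφ).contMDiffAt (by
      rw [← φ.extend_target']
      exact ht.mem_nhds hy)).mdifferentiableAt (by simp)
  have h2 : MDifferentiableAt I 𝓘(ℝ, E) (φ.extend I) ((φ.extend I).symm y) :=
    ((φ.contMDiffOn_extend hφ).contMDiffAt (φ.open_source.mem_nhds hx)).mdifferentiableAt (by simp)
  have h3 := mfderiv_comp y h2 h1
  have h4 : (φ.extend I) ∘ (φ.extend I).symm =ᶠ[𝓝 y] id := by
    filter_upwards [ht.mem_nhds hy] with z hz using (φ.extend I).right_inv hz
  rw [h4.mfderiv_eq, mfderiv_id] at h3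
  have hinj : Function.Injective (mfderiv 𝓘(ℝ, E) I (φ.extend I).symm y : E → E) := by
    intro a b hab
    have h5 : ∀ c : E, mfderiv I 𝓘(ℝ, E) (φ.extend I) ((φ.extend I).symm y)
        (mfderiv 𝓘(ℝ, E) I (φ.extend I).symm y c) = c := fun c =>
      (DFunLike.congr_fun h3 c).symm
    rw [← h5 a, ← h5 b]
    exact congrArg _ hab
  refine ⟨hinj, ?_⟩
  let A : E →L[ℝ] E := mfderiv 𝓘(ℝ, E) I (φ.extend I).symm y
  exact (LinearMap.injective_iff_surjective (f := A.toLinearMap)).1 hinj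

omit [IsManifold (𝓡 (2 * m)) ∞ P] in
/-- The Liouville form vanishes on curves in the cylinder over a Legendrian submanifold. -/
theorem expContactForm_velocity_eq_zero {lam : OneForm (𝓡 (2 * m)) P} {LamP : Set (P × ℝ)}
    (hLam : IsClosedLegendrian lam LamP) {γ : ℝ → ℝ × (P × ℝ)}
    (hγ : ContMDiffAt 𝓘(ℝ, ℝ) (sympModel m) ∞ γ 0) (hγL : ∀ᶠ t in 𝓝 0, (γ t).2 ∈ LamP) :
    (expContactForm lam (γ 0) : SympSpace m →L[ℝ] ℝ) (mfderiv 𝓘(ℝ, ℝ) (sympModel m) γ 0 (1 : ℝ)) =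
      0 := by
  have h1 : ContMDiffAt 𝓘(ℝ, ℝ) (contModel m) ∞ (fun t => (γ t).2) 0 := hγ.snd
  have h2 : (velocity (contModel m) (fun t => (γ t).2) : EuclideanSpace ℝ (Fin (2 * m)) × ℝ) =
      (mfderiv 𝓘(ℝ, ℝ) (sympModel m) γ 0 (1 : ℝ) : SympSpace m).2 := by
    have h3 := (hasMFDerivAt_snd (I := 𝓘(ℝ, ℝ)) (I' := contModel m) (γ 0)).comp 0
      (hγ.mdifferentiableAt (by simp)).hasMFDerivAt
    have h4 : HasMFDerivAt 𝓘(ℝ, ℝ) (contModel m) (fun t => (γ t).2) 0 _ := h3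
    unfold velocity
    rw [h4.mfderiv]
    rfl
  -- The form `e^s α` sees only the projection of the velocity to `P × ℝ`, which is tangent to the
  -- Legendrian.
  have h3 := hLam.legendrian (γ 0).2 hγL.self_of_nhds
    (velocity (contModel m) (fun t => (γ t).2)) ⟨fun t => (γ t).2, rfl, ⟨h1, hγL⟩, rfl⟩
  refine (expContactForm_apply_eq_contactForm lam (γ 0) _).trans ?_
  rw [← h2]
  exact mul_eq_zero_of_right _ h3

/-- A relative Darboux chart centered at a point of the cylinder over a Legendrian submanifold. -/
theorem exists_relative_darboux_chart {lam : OneForm (𝓡 (2 * m)) P} (hlam : IsLiouvilleForm lam)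
    {LamP : Set (P × ℝ)} (hLam : IsClosedLegendrian lam LamP) {L : Set (ℝ × (P × ℝ))}
    (hL : IsEmbeddedSubmanifold (sympModel m) (m + 1) L) {sP : ℝ}
    (hLP : ∀ x : ℝ × (P × ℝ), sP < x.1 → (x ∈ L ↔ x.2 ∈ LamP)) (hne : LamP.Nonempty) :
    ∃ O : Set (StdSpace (m + 1)), IsOpen O ∧ 0 ∈ O ∧ ∃ F : StdSpace (m + 1) → ℝ × (P × ℝ),
      ContMDiffOn 𝓘(ℝ, StdSpace (m + 1)) (sympModel m) ∞ F O ∧ InjOn F O ∧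
      (∀ z ∈ O, sP < (F z).1) ∧ (∀ z ∈ O, F z ∈ L ↔ z ∈ realPlane (m + 1)) ∧
      ∀ z ∈ O, ∀ v w, bilinExtDeriv ((expContactForm lam).pullback F) z v w = stdForm v w := by
  obtain ⟨q, hq⟩ := hne
  -- The centre lies strictly above `sP`, so a whole neighbourhood lies in the cylindrical region.
  have hpL : ((sP + 1, q) : ℝ × (P × ℝ)) ∈ L := (hLP _ (by simp)).2 hq
  obtain ⟨φ, hφ, hpφ, V, hVn, hV⟩ := hL _ hpL
  set e := φ.extend (sympModel m) with he
  set κ : SympSpace m → ℝ × (P × ℝ) := fun y => e.symm y with hκ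
  have het : IsOpen e.target := φ.isOpen_extend_target
  have hes : e.source = φ.source := φ.extend_source
  have hκs : ContMDiffOn 𝓘(ℝ, SympSpace m) (sympModel m) ∞ κ e.target := by
    have := contMDiffOn_extend_symm (I := sympModel m) hφ
    rwa [← φ.extend_target'] at this
  set W : Set (SympSpace m) := e.target ∩ κ ⁻¹' {x | sP < x.1} with hWdef
  have hW : IsOpen W := hκs.continuousOn.isOpen_inter_preimage het
    (isOpen_lt continuous_const continuous_fst)
  set y₀ : SympSpace m := e (sP + 1, q) with hy₀
  have hp : κ y₀ = (sP + 1, q) := e.left_inv (hes ▸ hpφ)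
  have hy₀t : y₀ ∈ e.target := e.map_source (hes ▸ hpφ)
  have hy₀W : y₀ ∈ W := ⟨hy₀t, by rw [mem_preimage, hp]; simp⟩
  have hκV : ∀ y ∈ e.target, κ y ∈ L ↔ y ∈ V := fun y hy => by
    have h1 : κ y ∈ φ.source := hes ▸ e.map_target hy
    rw [hV _ h1]
    have h2 : e (κ y) = y := e.right_inv hy
    exact iff_of_eq (congrArg (· ∈ V) h2)
  have hβ := isSmooth_expContactForm hlam.smooth
  have hκW := hκs.mono (inter_subset_left (s := e.target) (t := κ ⁻¹' {x | sP < x.1}))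
  have hnd : ∀ v, (∀ w, bilinExtDeriv ((expContactForm lam).pullback κ) y₀ v w = 0) → v = 0 := by
    intro v hv
    have hbij := bijective_mfderiv_extend_symm hφ hy₀t
    refine hbij.1 (a₂ := 0) ?_
    refine Eq.trans ?_ (map_zero (mfderiv 𝓘(ℝ, SympSpace m) (sympModel m) κ y₀)).symm
    refine sympForm_nondegenerate hlam (κ y₀) _ fun w => ?_
    obtain ⟨w, rfl⟩ := hbij.2 w
    exact (hβ.d_mfderiv het hκs hy₀t v w).trans (hv w)
  -- The chart carries the line `y + t v` in `V` to a curve in the cylinder over `LamP`, on whose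
  -- velocity `e^s α` vanishes.
  have hV0 : ∀ y ∈ W, y ∈ V → ∀ v ∈ V, (expContactForm lam).pullback κ y v = 0 := by
    intro y hy hyV v hv
    have hg : HasFDerivAt (fun t : ℝ => y + t • v) ((ContinuousLinearMap.id ℝ ℝ).smulRight v) 0 :=
      ((hasFDerivAt_id (0 : ℝ)).smul_const v).const_add y
    have hg0 : y + (0 : ℝ) • v = y := by simp
    have hmem : ∀ᶠ t in 𝓝 (0 : ℝ), y + t • v ∈ W :=
      hg.continuousAt.eventually_mem (by rw [hg0]; exact hW.mem_nhds hy)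
    have hκy : ContMDiffAt 𝓘(ℝ, SympSpace m) (sympModel m) ∞ κ (y + (0 : ℝ) • v) := by
      rw [hg0]
      exact hκW.contMDiffAt (hW.mem_nhds hy)
    have hgs : ContMDiffAt 𝓘(ℝ, ℝ) 𝓘(ℝ, SympSpace m) ∞ (fun t : ℝ => y + t • v) 0 := by
      rw [contMDiffAt_iff_contDiffAt]
      fun_prop
    have h1 := expContactForm_velocity_eq_zero hLam (γ := κ ∘ fun t : ℝ => y + t • v)
      (ContMDiffAt.comp (0 : ℝ) hκy hgs) (by
        filter_upwards [hmem] with t ht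
        exact (hLP _ ht.2).1 ((hκV _ ht.1).2 (V.add_mem hyV (V.smul_mem t hv))))
    have h2 := OneForm.pullback_comp (expContactForm lam) (F := κ) (y := (0 : ℝ))
      (g := fun t : ℝ => y + t • v) (hκy.mdifferentiableAt (by simp)) hg.differentiableAt
    have h3 := (DFunLike.congr_fun h2 1).symm.trans h1
    rw [hg.fderiv] at h3
    simpa using h3
  have hfin : 2 * Module.finrank ℝ V = Module.finrank ℝ (SympSpace m) := by
    rw [hVn, Module.finrank_prod, Module.finrank_prod, Module.finrank_self,
      finrank_euclideanSpace_fin]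
    ring
  obtain ⟨O, hO, h0O, ψ, hψ, hψW, hψi, hψV, hψs⟩ := exists_relative_darboux_ball hW hy₀W
    (hβ.contDiffOn_pullback hW hκW) hnd ((hκV y₀ hy₀t).1 (hp ▸ hpL)) hVn hfin hV0
  refine ⟨O, hO, h0O, κ ∘ ψ, hκW.comp hψ.contMDiffOn hψW, ?_, fun z hz => (hψW hz).2,
    fun z hz => ?_, fun z hz v w => ?_⟩
  · intro z hz z' hz' h
    exact hψi hz hz' (e.symm.injOn (hψW hz).1 (hψW hz').1 h)
  · rw [← hψV z hz]
    exact hκV _ (hψW hz).1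
  · have h1 : (expContactForm lam).pullback (κ ∘ ψ) =ᶠ[𝓝 z] fun z =>
        ((expContactForm lam).pullback κ (ψ z)).comp (fderiv ℝ ψ z) := by
      filter_upwards [hO.mem_nhds hz] with z hz
      exact OneForm.pullback_comp _
        ((hκW.contMDiffAt (hW.mem_nhds (hψW hz))).mdifferentiableAt (by simp))
        ((hψ.contDiffAt (hO.mem_nhds hz)).differentiableAt (by simp))
    rw [← hψs z hz, ← bilinExtDeriv_pullback (((hβ.contDiffOn_pullback hW hκW).contDiffAt
      (hW.mem_nhds (hψW hz))).differentiableAt (by simp)) (hψ.contDiffAt (hO.mem_nhds hz))]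
    unfold bilinExtDeriv
    rw [h1.fderiv_eq]

/-- Translating a relative Darboux chart along the cylinder and rescaling it. -/
theorem isRelSymplecticEmbedding_translate {lam : OneForm (𝓡 (2 * m)) P}
    (hlam : IsLiouvilleForm lam) {LamP : Set (P × ℝ)} {L : Set (ℝ × (P × ℝ))} {sP : ℝ}
    (hLP : ∀ x : ℝ × (P × ℝ), sP < x.1 → (x ∈ L ↔ x.2 ∈ LamP)) {O : Set (StdSpace (m + 1))}
    (hO : IsOpen O) {F : StdSpace (m + 1) → ℝ × (P × ℝ)}
    (hF : ContMDiffOn 𝓘(ℝ, StdSpace (m + 1)) (sympModel m) ∞ F O) (hFi : InjOn F O)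
    (hFs : ∀ z ∈ O, sP < (F z).1) (hFL : ∀ z ∈ O, F z ∈ L ↔ z ∈ realPlane (m + 1))
    (hFω : ∀ z ∈ O, ∀ v w, bilinExtDeriv ((expContactForm lam).pullback F) z v w = stdForm v w)
    {r : ℝ} (hr : Metric.closedBall 0 r ⊆ O) {σ : ℝ} (hσ : 0 ≤ σ) {s₀ : EReal}
    (hs₀ : s₀ < ((sP + σ : ℝ) : EReal)) :
    IsRelSymplecticEmbedding lam (slab P s₀ ⊤) (portion L s₀ ⊤) (Real.exp (σ / 2) * r)
      (fun z => ((F (Real.exp (-(σ / 2)) • z)).1 + σ, (F (Real.exp (-(σ / 2)) • z)).2)) := by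
  -- Rescaling by `c` multiplies `ω₀` by `c² = e^{-σ}`, which compensates the factor `e^σ` from the
  -- translation.
  set c := Real.exp (-(σ / 2)) with hc
  have hc0 : 0 < c := Real.exp_pos _
  have hce : c * Real.exp (σ / 2) = 1 := by rw [hc, ← Real.exp_add]; simp
  have hcσ : Real.exp σ * (c * c) = 1 := by
    rw [hc, ← Real.exp_add, ← Real.exp_add]
    ring_nf
    simp
  set T : StdSpace (m + 1) →L[ℝ] StdSpace (m + 1) := c • ContinuousLinearMap.id ℝ _ with hT
  have hTz : ∀ z, T z = c • z := fun z => rfl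
  set O' : Set (StdSpace (m + 1)) := T ⁻¹' O with hO'def
  have hO' : IsOpen O' := hO.preimage T.continuous
  have hball : Metric.closedBall 0 (Real.exp (σ / 2) * r) ⊆ O' := by
    intro z hz
    refine hr ?_
    rw [mem_closedBall_zero_iff] at hz ⊢
    rw [hTz, norm_smul, Real.norm_of_nonneg hc0.le]
    calc c * ‖z‖ ≤ c * (Real.exp (σ / 2) * r) := by gcongr
      _ = r := by rw [← mul_assoc, hce, one_mul]
  have hFT : ContMDiffOn 𝓘(ℝ, StdSpace (m + 1)) (sympModel m) ∞ (F ∘ T) O' :=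
    hF.comp T.contDiff.contMDiff.contMDiffOn fun z hz => hz
  set Ψ : StdSpace (m + 1) → ℝ × (P × ℝ) := fun z => ((F (c • z)).1 + σ, (F (c • z)).2) with hΨ
  have hΨs : ContMDiffOn 𝓘(ℝ, StdSpace (m + 1)) (sympModel m) ∞ Ψ O' := by
    refine ContMDiffOn.prodMk ?_ (contMDiff_snd.comp_contMDiffOn hFT)
    exact ((contDiff_id.add contDiff_const).contMDiff (f := fun s : ℝ => s + σ)).comp_contMDiffOn
      (contMDiff_fst.comp_contMDiffOn hFT)
  have hpull : ∀ z ∈ O', (expContactForm lam).pullback Ψ z =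
      Real.exp σ • ((expContactForm lam).pullback F (T z)).comp (fderiv ℝ T z) := by
    intro z hz
    rw [← OneForm.pullback_comp _ ((hF.contMDiffAt (hO.mem_nhds hz)).mdifferentiableAt (by simp))
      T.differentiableAt, pullback_expContactForm lam
        ((hΨs.contMDiffAt (hO'.mem_nhds hz)).mdifferentiableAt (by simp)),
      pullback_expContactForm lam
        ((hFT.contMDiffAt (hO'.mem_nhds hz)).mdifferentiableAt (by simp)), smul_smul,
      ← Real.exp_add, add_comm σ]
    rfl
  have hβ := isSmooth_expContactForm hlam.smooth
  have hform : ∀ z ∈ O', ∀ v w,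
      bilinExtDeriv ((expContactForm lam).pullback Ψ) z v w = stdForm v w := by
    intro z hz v w
    have h1 : (expContactForm lam).pullback Ψ =ᶠ[𝓝 z] fun z =>
        Real.exp σ • ((expContactForm lam).pullback F (T z)).comp (fderiv ℝ T z) := by
      filter_upwards [hO'.mem_nhds hz] with z hz using hpull z hz
    have h2 : DifferentiableAt ℝ ((expContactForm lam).pullback F) (T z) :=
      ((hβ.contDiffOn_pullback hO hF).contDiffAt (hO.mem_nhds hz)).differentiableAt (by simp)
    have h3 : DifferentiableAt ℝ
        (fun z => ((expContactForm lam).pullback F (T z)).comp (fderiv ℝ T z)) z := by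
      simp only [ContinuousLinearMap.fderiv]
      exact (h2.comp z T.differentiableAt).clm_comp (differentiableAt_const _)
    have h4 := bilinExtDeriv_pullback h2 T.contDiff.contDiffAt v w
    rw [hFω _ hz, T.fderiv] at h4
    have h5 : bilinExtDeriv ((expContactForm lam).pullback Ψ) z = Real.exp σ •
        bilinExtDeriv (fun z => ((expContactForm lam).pullback F (T z)).comp (fderiv ℝ T z)) z := by
      unfold bilinExtDeriv
      rw [h1.fderiv_eq, fderiv_fun_const_smul h3, map_smul]
    rw [h5, smul_apply, smul_apply, h4, hTz, hTz]
    simp only [stdForm, PiLp.smul_apply, smul_eq_mul, Finset.mul_sum]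
    refine Finset.sum_congr rfl fun i _ => ?_
    linear_combination (v (Sum.inl i) * w (Sum.inr i) - v (Sum.inr i) * w (Sum.inl i)) * hcσ
  have hslab : ∀ z ∈ O', Ψ z ∈ slab P s₀ ⊤ := fun z hz => by
    refine ⟨hs₀.trans ?_, EReal.coe_lt_top _⟩
    exact EReal.coe_lt_coe_iff.2 (add_lt_add_left (hFs _ hz) σ)
  refine ⟨⟨O', hO', hball, hΨs⟩, ?_, fun z hz => hslab z (hball hz), fun z hz v w => ?_,
    fun z hz => ?_⟩
  · intro z hz z' hz' h
    have h1 : F (c • z) = F (c • z') := by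
      simp only [hΨ, Prod.mk.injEq, add_left_inj] at h
      exact Prod.ext h.1 h.2
    exact smul_right_injective _ hc0.ne' (hFi (hball hz) (hball hz') h1)
  · exact (hβ.d_mfderiv hO' hΨs (hball hz) v w).trans (hform z (hball hz) v w)
  · have h1 : sP < (F (c • z)).1 := hFs _ (hball hz)
    -- Both points lie above `sP`, as `σ ≥ 0`, and have the same `P × ℝ`-component, which alone
    -- decides membership in `L` there.
    have h2 : Ψ z ∈ L ↔ F (c • z) ∈ L := by
      rw [hLP _ h1, hLP (Ψ z) (by simp only [hΨ]; linarith)]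
    have h3 : F (c • z) ∈ L ↔ c • z ∈ realPlane (m + 1) := hFL _ (hball hz)
    rw [portion, mem_inter_iff, and_iff_left (hslab z (hball hz)), h2, h3]
    simp [realPlane, hc0.ne']

end CylindricalEnd

/-! ### Infinite width of the positive end -/

theorem lemma3p2 {m : ℕ} {P : Type*} [TopologicalSpace P] [T2Space P]
    [SecondCountableTopology P] [ChartedSpace (EuclideanSpace ℝ (Fin (2 * m))) P]
    [IsManifold (𝓡 (2 * m)) ∞ P]
    (lam : OneForm (𝓡 (2 * m)) P) (hlam : IsLiouvilleForm lam)
    (LamM LamP : Set (P × ℝ)) (L : Set (ℝ × (P × ℝ)))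
    (hL : IsLagrangianCobordism lam LamM LamP L)
    (hLamP : LamP.Nonempty)
    (s₀ : EReal) (hs₀ : s₀ < ⊤) :
    relWidth lam L s₀ ⊤ = ⊤ := by
  obtain ⟨-, sP, -, -, hP, -⟩ := hL.cylindrical_exact
  have hLP : ∀ x : ℝ × (P × ℝ), sP < x.1 → (x ∈ L ↔ x.2 ∈ LamP) := fun x hx => by
    have h1 := Set.ext_iff.1 hP x
    simpa [hx.le] using h1
  obtain ⟨O, hO, h0O, F, hF, hFi, hFs, hFL, hFω⟩ :=
    exists_relative_darboux_chart hlam hL.legendrianP hL.submanifold hLP hLamP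
  obtain ⟨r, hr, hrO⟩ := Metric.nhds_basis_closedBall.mem_iff.1 (hO.mem_nhds h0O)
  obtain ⟨b, hb⟩ : ∃ b : ℝ, s₀ < (b : EReal) :=
    EReal.lt_iff_exists_real_btwn.1 hs₀ |>.imp fun _ h => h.1
  have hlim : Tendsto (fun σ : ℝ => Real.pi * (Real.exp (σ / 2) * r) ^ 2) atTop atTop := by
    refine Tendsto.const_mul_atTop Real.pi_pos ((tendsto_pow_atTop two_ne_zero).comp ?_)
    exact (Real.tendsto_exp_atTop.comp (tendsto_id.atTop_div_const two_pos)).atTop_mul_const hr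
  refine ENNReal.eq_top_of_forall_nnreal_le fun N => ?_
  -- `σ ≥ 0` keeps the translate in the cylindrical end, `σ ≥ b - sP` puts it above `s₀`, and the
  -- first bound makes its capacity at least `N`.
  obtain ⟨σ, hσN, hσ0, hσb⟩ := ((hlim.eventually_ge_atTop (N : ℝ)).and
    ((eventually_ge_atTop 0).and (eventually_ge_atTop (b - sP)))).exists
  have hN : (N : ENNReal) ≤ ENNReal.ofReal (Real.pi * (Real.exp (σ / 2) * r) ^ 2) := by
    rw [← ENNReal.ofReal_coe_nnreal]
    exact ENNReal.ofReal_le_ofReal hσN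
  refine hN.trans (le_sSup ⟨_, mul_pos (Real.exp_pos _) hr, rfl, _,
    isRelSymplecticEmbedding_translate hlam hLP hO hF hFi hFs hFL hFω hrO hσ0 ?_⟩)
  exact hb.trans_le (EReal.coe_le_coe_iff.2 (by linarith))

end
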